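/- **Setting.** Let $(Y_i,X_i,Z_i,\varepsilon_{i1},\dots,\varepsilon_{ik})$, $i=1,2,\dots$, be i.i.d., with $Y_i\in\mathbb R$, $X_i\in\mathbb R^p$, $Z_i\in\mathbb R^q$ ($q=0$ allowed), $\varepsilon_{ij}\in\mathbb R^p$ and $k\ge2$; the errors $\varepsilon_{i1},\dots,\varepsilon_{ik}$ have mean zero and are independent of each other and of $(Y_i,X_i,Z_i)$. One observes $Y_i$, $Z_i$ and proxies $X^*_{i1},\dots,X^*_{ik}$, where each $j$ is either additive, $X^*_{ij}=\eta_{0j}+\eta_{1j}\circ X_i+\varepsilon_{ij}$, or multiplicative, $X^*_{ij}=\eta_{0j}+\eta_{1j}\circ X_i\circ(1+\varepsilon_{ij})$, with constants $\eta_{0j},\eta_{1j}\in\mathbb R^p$, all entries of $\eta_{1j}$ nonzero. It is known that $\eta_{0j}=0$ for $j\in J_0$ and $\eta_{1j}=1$ for $j\in J_1$, where $J_0,J_1\neq\emptyset$. Write $\mu_A=E(A)$, $\Sigma_{AB}=\mathrm{cov}(A,B)$, $\mu_j=\mu_{X^*_j}$, and $H_j$ for the diagonal matrix of $\eta_{1j}$.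 **Correction parameters.** $\xi$ collects $\mu_j,\Sigma_{X_j^*X_l^*},\mu_Z,\Sigma_{ZZ},\Sigma_{ZX_j^*},\mu_X,\Sigma_{XX},\Sigma_{ZX},\eta_{0j},H_j,M_j,\Sigma_{XX_j^*}$, with true value $\xi_0$; here $M_j=\mathrm{cov}(\varepsilon_j)$ if $j$ is additive and $M_j=H_j\{E(XX^T)\circ\mathrm{cov}(\varepsilon_j)\}H_j$ if it is multiplicative. The estimating function $g(X^*,Z;\xi)$ has the components $X_j^*-\mu_j$; $(X_j^*-\mu_j)(X_l^*-\mu_l)^T-\Sigma_{X_j^*X_l^*}$; $Z-\mu_Z$; $(Z-\mu_Z)(Z-\mu_Z)^T-\Sigma_{ZZ}$; $(Z-\mu_Z)(X_j^*-\mu_j)^T-\Sigma_{ZX_j^*}$; $|J_0|^{-1}(\sum_{j\in J_0\cap J_1}\mu_j+\sum_{j\in J_0\setminus J_1}H_j^{-1}\mu_j)-\mu_X$; $k^{-1}\sum_j\Sigma_{XX_j^*}H_j^{-1}-\Sigma_{XX}$; $|J_1|^{-1}\sum_{j\in J_1}\Sigma_{ZX_j^*}-\Sigma_{ZX}$; $\mu_j-H_j\mu_X-\eta_{0j}$;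 $\Sigma_{X_j^*X_j^*}-H_j\Sigma_{XX}H_j-M_j$; and the equations for $H_j$ and $\Sigma_{XX_j^*}$ of one of two schemes: (a) $(k-1)^{-1}\sum_{l\ne j}\Sigma_{X_j^*X_l^*}\Sigma_{XX_l^*}^{-1}-H_j$ and $|J_1\setminus\{j\}|^{-1}\sum_{l\in J_1\setminus\{j\}}\Sigma_{X_l^*X_j^*}-\Sigma_{XX_j^*}$, where it is assumed that $|J_1|>1$ and that the true $\Sigma_{XX}$ is nonsingular; (b) $\mathrm{diag}_r\big[\{(\Sigma_{XZ}\Sigma_{ZX})_{rr}^{-1}(\Sigma_{X_j^*Z}\Sigma_{ZX_j^*})_{rr}\}^{1/2}\big]-H_j$ and $(k-1)^{-1}\sum_{l\neq j}H_l^{-1}\Sigma_{X_l^*X_j^*}-\Sigma_{XX_j^*}$, where it is assumed that all entries of $\eta_{1j}$ are positive and every column of the true $\Sigma_{ZX}$ is nonzero. **Predictor.** For $\tau=(\mu,\beta,\gamma,\alpha,\lambda)$ let $\widehat X_\tau=\mu+\beta\sum_j\alpha_jX_j^*+\gamma Z$. The weights $\alpha_j\ge0$, $\sum_j\alpha_j=1$,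 are either fixed at $\alpha^0$ or optimized. Let $\tau_0$ (with $\lambda=0$) minimize $E\|X-\widehat X_\tau\|^2$ over $\mu,\beta,\gamma$ and the allowed weights. With $C_j=\Sigma_{XX_j^*}-\beta\sum_l\alpha_l\Sigma_{X_l^*X_j^*}-\gamma\Sigma_{ZX_j^*}$, the first-order equations $h(\tau,\xi)=0$ are $$\mu_X-\mu-\beta\sum_j\alpha_j\mu_j-\gamma\mu_Z=0,\quad \sum_j\alpha_jC_j=0,\quad \Sigma_{XZ}-\beta\sum_j\alpha_j\Sigma_{X_j^*Z}-\gamma\Sigma_{ZZ}=0,$$ together with $\alpha-\alpha^0=0$, $\lambda=0$ for fixed weights, or $\mathrm{tr}(\beta^TC_j)-\lambda=0$ for all $j$, $\sum_j\alpha_j-1=0$ for optimized weights. **Estimator.** Let $\Psi(y,x,z;\Theta)\in\mathbb R^m$ be an estimating function for $\Theta\in\mathbb R^m$, and let $\Theta_{RC}$ satisfy $E\{\Psi(Y,\widehat X_{\tau_0},Z;\Theta_{RC})\}=0$. Let $\psi=(\Psi(Y,\widehat X_\tau,Z;\Theta),\,h(\tau,\xi),\,g(X^*,Z;\xi))$ be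 the stacked estimating function of $\theta=(\Theta,\tau,\xi)$, and $\theta_0=(\Theta_{RC},\tau_0,\xi_0)$. Let $(\widehat\Theta_{RC},\widehat\tau,\widehat\xi)$ be such that, with probability tending to one, $\widehat\Theta_{RC}\in K_\Theta$, $\widehat\tau\in K_\tau$ and $n^{-1}\sum_{i=1}^n\psi_i(\widehat\theta)=0$ (with $\widehat\Theta_{RC}$ measurable). **Regularity conditions.** $X$, $Z$, $\varepsilon_j$ have finite fourth moments; $K_\Theta\ni\Theta_{RC}$ and $K_\tau\ni\tau_0$ are compact; $\Theta_{RC}$ is the only root in $K_\Theta$ of $E\{\Psi(Y,\widehat X_{\tau_0},Z;\cdot)\}=0$, and $\tau_0$ is the only root in $K_\tau$ of $h(\cdot,\xi_0)=0$; optimized weights have all $\alpha_j>0$ at $\tau_0$; $\Psi$ is measurable in the data; there are open sets $W\ni\Theta_{RC}$, $V\ni\tau_0$ such that almost surely $(\Theta,\tau)\mapsto\Psi(Y,\widehat X_\tau,Z;\Theta)$ is continuous on $K_\Theta\times V$ and $C^1$ on $W\times V$, with its norm on the former set and the norm of its derivative on the latter bounded by an integrable function of the observation; $E\|\Psi(Y,\widehat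 X_{\tau_0},Z;\Theta_{RC})\|^2<\infty$; and $A_{RC}=E\{\partial\psi/\partial\theta^T(\theta_0)\}$ is nonsingular. **Theorem.** Under these conditions $\widehat\Theta_{RC}\to\Theta_{RC}$ in probability, and as $n\to\infty$ $$n^{1/2}(\widehat\Theta_{RC}-\Theta_{RC})\ \xrightarrow{d}\ N\big(0,\;Q A_{RC}^{-1}B_{RC}A_{RC}^{-T}Q^T\big),$$ where $B_{RC}=E\{\psi(\theta_0)\psi(\theta_0)^T\}$ and $Q=[\,I_m\ \ 0\,]$. Moreover the limiting covariance matrix is positive semidefinite, $A_{RC}$ is block upper triangular with respect to $(\Theta,\tau,\xi)$, $B_{RC}$ is symmetric, and the blocks of $B_{RC}$ that involve $h$ vanish. -/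

import Mathlib

open MeasureTheory ProbabilityTheory Filter Topology Matrix

noncomputable section

namespace RC

/-! ### Data and the generalized measurement error model -/

/-- The two error structures a proxy may have. -/
inductive ErrorKind
  | additive
  | multiplicative

/-- The constants of a generalized measurement error model with `k` proxies of a covariate in `ℝ^p`:
the error structure of each proxy, the intercepts `η₀ⱼ`, the slopes `η₁ⱼ`, and the index sets of the
proxies that are known to have intercept `0` (`J0`) or slope `1` (`J1`). -/
structure ErrorModel (p k : ℕ) where
  kind : Fin k → ErrorKind
  eta0 : Fin k → Fin p → ℝ
  eta1 : Fin k → Fin p → ℝ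
  J0 : Finset (Fin k)
  J1 : Finset (Fin k)

/-- The random quantities of the subjects `i = 0, 1, 2, …`: outcome, true covariate, error-free
covariates, and the error of each of the `k` proxies (the product of the scale `δⱼ` and the
standardized error `Uᵢⱼ`). -/
structure Subjects (Ω : Type*) (p q k : ℕ) where
  Y : ℕ → Ω → ℝ
  X : ℕ → Ω → Fin p → ℝ
  Z : ℕ → Ω → Fin q → ℝ
  err : ℕ → Fin k → Ω → Fin p → ℝ

/-- What is observed on one subject: the outcome, the `k` proxies and the error-free covariates. -/
abbrev Obs (p q k : ℕ) : Type := ℝ × (Fin k → Fin p → ℝ) × (Fin q → ℝ)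

variable {Ω : Type*} {p q k m : ℕ}

/-- The `j`-th proxy as a function of the true covariate and the error: `η₀ⱼ + η₁ⱼ ∘ x + e`
or `η₀ⱼ + η₁ⱼ ∘ x ∘ (1 + e)`. -/
def ErrorModel.proxy (M : ErrorModel p k) (j : Fin k) (x e : Fin p → ℝ) : Fin p → ℝ :=
  match M.kind j with
  | .additive => fun r => M.eta0 j r + M.eta1 j r * x r + e r
  | .multiplicative => fun r => M.eta0 j r + M.eta1 j r * (x r * (1 + e r))

/-- The proxy `X*ᵢⱼ`. -/
def Subjects.Xstar (S : Subjects Ω p q k) (M : ErrorModel p k) (i : ℕ) (j : Fin k) (ω : Ω) :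
    Fin p → ℝ :=
  M.proxy j (S.X i ω) (S.err i j ω)

/-- The observation on subject `i`. -/
def Subjects.obs (S : Subjects Ω p q k) (M : ErrorModel p k) (i : ℕ) (ω : Ω) : Obs p q k :=
  (S.Y i ω, fun j => S.Xstar M i j ω, S.Z i ω)

/-- The law of the observation on one subject. -/
def Subjects.obsLaw [MeasurableSpace Ω] (S : Subjects Ω p q k) (M : ErrorModel p k)
    (P : Measure Ω) : Measure (Obs p q k) :=
  P.map (S.obs M 0)

/-- The generalized measurement error model: the subjects are independent and identically
distributed, the errors have mean zero and are independent of each other and of `(Y, X, Z)`, and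
the restrictions recorded by `J0` and `J1` hold. -/
structure IsMeasurementErrorModel [MeasurableSpace Ω] (P : Measure Ω) (S : Subjects Ω p q k)
    (M : ErrorModel p k) : Prop where
  measurable_Y : ∀ i, Measurable (S.Y i)
  measurable_X : ∀ i, Measurable (S.X i)
  measurable_Z : ∀ i, Measurable (S.Z i)
  measurable_err : ∀ i j, Measurable (S.err i j)
  indep_subjects : iIndepFun (fun i ω => (S.Y i ω, S.X i ω, S.Z i ω, fun j => S.err i j ω)) P
  ident_subjects : ∀ i, IdentDistrib
    (fun ω => (S.Y i ω, S.X i ω, S.Z i ω, fun j => S.err i j ω))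
    (fun ω => (S.Y 0 ω, S.X 0 ω, S.Z 0 ω, fun j => S.err 0 j ω)) P P
  indep_err : iIndepFun (fun j => S.err 0 j) P
  indep_err_data : IndepFun (fun ω => (S.Y 0 ω, S.X 0 ω, S.Z 0 ω))
    (fun ω j => S.err 0 j ω) P
  integrable_err : ∀ j r, Integrable (fun ω => S.err 0 j ω r) P
  mean_err : ∀ j r, ∫ ω, S.err 0 j ω r ∂P = 0
  eta0_of_mem : ∀ j ∈ M.J0, M.eta0 j = 0
  eta1_of_mem : ∀ j ∈ M.J1, M.eta1 j = 1

/-! ### Correction parameters -/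

/-- Which of the two families of correction parameter estimators is used: the one that works with
the proxies alone, or the one that works with the error-free covariates. -/
inductive Scheme
  | proxies
  | covariates

/-- The coordinates of the vector `ξ` of correction parameters: `μⱼ`, `Σ_{X*ⱼX*ₗ}`, `μ_Z`, `Σ_ZZ`,
`Σ_{ZX*ⱼ}`, `μ_X`, `Σ_XX`, `Σ_ZX`, `η₀ⱼ`, `η₁ⱼ` (as a matrix), `Mⱼ`, `Σ_{XX*ⱼ}`. -/
inductive XiIdx (p q k : ℕ)
  | mu (j : Fin k) (r : Fin p)
  | sig (j l : Fin k) (r s : Fin p)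
  | muZ (a : Fin q)
  | sigZZ (a b : Fin q)
  | sigZXstar (j : Fin k) (a : Fin q) (r : Fin p)
  | muX (r : Fin p)
  | sigXX (r s : Fin p)
  | sigZX (a : Fin q) (r : Fin p)
  | eta0 (j : Fin k) (r : Fin p)
  | eta1 (j : Fin k) (r s : Fin p)
  | errVar (j : Fin k) (r s : Fin p)
  | sigXXstar (j : Fin k) (r s : Fin p)
  deriving DecidableEq, Fintype

/-- The space of correction parameters. -/
abbrev Xi (p q k : ℕ) : Type := XiIdx p q k → ℝ

namespace Xi

def mu (ξ : Xi p q k) (j : Fin k) : Fin p → ℝ := fun r => ξ (.mu j r)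
def sig (ξ : Xi p q k) (j l : Fin k) : Matrix (Fin p) (Fin p) ℝ := .of fun r s => ξ (.sig j l r s)
def muZ (ξ : Xi p q k) : Fin q → ℝ := fun a => ξ (.muZ a)
def sigZZ (ξ : Xi p q k) : Matrix (Fin q) (Fin q) ℝ := .of fun a b => ξ (.sigZZ a b)
def sigZXstar (ξ : Xi p q k) (j : Fin k) : Matrix (Fin q) (Fin p) ℝ :=
  .of fun a r => ξ (.sigZXstar j a r)
def muX (ξ : Xi p q k) : Fin p → ℝ := fun r => ξ (.muX r)
def sigXX (ξ : Xi p q k) : Matrix (Fin p) (Fin p) ℝ := .of fun r s => ξ (.sigXX r s)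
def sigZX (ξ : Xi p q k) : Matrix (Fin q) (Fin p) ℝ := .of fun a r => ξ (.sigZX a r)
def eta0 (ξ : Xi p q k) (j : Fin k) : Fin p → ℝ := fun r => ξ (.eta0 j r)
def eta1 (ξ : Xi p q k) (j : Fin k) : Matrix (Fin p) (Fin p) ℝ := .of fun r s => ξ (.eta1 j r s)
def errVar (ξ : Xi p q k) (j : Fin k) : Matrix (Fin p) (Fin p) ℝ :=
  .of fun r s => ξ (.errVar j r s)
def sigXXstar (ξ : Xi p q k) (j : Fin k) : Matrix (Fin p) (Fin p) ℝ :=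
  .of fun r s => ξ (.sigXXstar j r s)

end Xi

/-- The estimator of the diagonal matrix of `η₁ⱼ`. Without error-free covariates it is the average
over `l ≠ j` of `Σ_{X*ⱼX*ₗ} Σ_{XX*ₗ}⁻¹`; with them each component is
`{(Σ_XZ Σ_ZX)⁻¹ Σ_{X*ⱼZ} Σ_{ZX*ⱼ}}^{1/2}`. -/
def eta1Formula (c : Scheme) (ξ : Xi p q k) (j : Fin k) : Matrix (Fin p) (Fin p) ℝ :=
  match c with
  | .proxies => ((k : ℝ) - 1)⁻¹ • ∑ l ∈ Finset.univ.erase j, ξ.sig j l * (ξ.sigXXstar l)⁻¹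
  | .covariates => Matrix.diagonal fun r =>
      √(((ξ.sigZXᵀ * ξ.sigZX) r r)⁻¹ * ((ξ.sigZXstar j)ᵀ * ξ.sigZXstar j) r r)

/-- The estimator of `Σ_{XX*ⱼ}`. -/
def sigXXstarFormula (c : Scheme) (M : ErrorModel p k) (ξ : Xi p q k) (j : Fin k) :
    Matrix (Fin p) (Fin p) ℝ :=
  match c with
  | .proxies => ((M.J1.erase j).card : ℝ)⁻¹ • ∑ l ∈ M.J1.erase j, ξ.sig l j
  | .covariates => ((k : ℝ) - 1)⁻¹ • ∑ l ∈ Finset.univ.erase j, (ξ.eta1 l)⁻¹ * ξ.sig l j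

/-- The estimator of `μ_X`. -/
def muXFormula (M : ErrorModel p k) (ξ : Xi p q k) : Fin p → ℝ :=
  (M.J0.card : ℝ)⁻¹ •
    (∑ j ∈ M.J0 ∩ M.J1, ξ.mu j + ∑ j ∈ M.J0 \ M.J1, (ξ.eta1 j)⁻¹ *ᵥ ξ.mu j)

/-- The estimating function `g` of the correction parameters, evaluated at proxies `x` and
error-free covariates `z`. -/
def gFun (c : Scheme) (M : ErrorModel p k) (x : Fin k → Fin p → ℝ) (z : Fin q → ℝ)
    (ξ : Xi p q k) : XiIdx p q k → ℝ
  | .mu j r => x j r - ξ.mu j r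
  | .sig j l r s => (x j r - ξ.mu j r) * (x l s - ξ.mu l s) - ξ.sig j l r s
  | .muZ a => z a - ξ.muZ a
  | .sigZZ a b => (z a - ξ.muZ a) * (z b - ξ.muZ b) - ξ.sigZZ a b
  | .sigZXstar j a r => (z a - ξ.muZ a) * (x j r - ξ.mu j r) - ξ.sigZXstar j a r
  | .muX r => muXFormula M ξ r - ξ.muX r
  | .sigXX r s =>
      ((k : ℝ)⁻¹ • ∑ j, ξ.sigXXstar j * (ξ.eta1 j)⁻¹) r s - ξ.sigXX r s
  | .sigZX a r => ((M.J1.card : ℝ)⁻¹ • ∑ j ∈ M.J1, ξ.sigZXstar j) a r - ξ.sigZX a r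
  | .eta0 j r => (ξ.mu j - ξ.eta1 j *ᵥ ξ.muX) r - ξ.eta0 j r
  | .eta1 j r s => eta1Formula c ξ j r s - ξ.eta1 j r s
  | .errVar j r s => (ξ.sig j j - ξ.eta1 j * ξ.sigXX * ξ.eta1 j) r s - ξ.errVar j r s
  | .sigXXstar j r s => sigXXstarFormula c M ξ j r s - ξ.sigXXstar j r s

/-- The true values of the correction parameters. -/
def trueXi [MeasurableSpace Ω] (P : Measure Ω) (S : Subjects Ω p q k) (M : ErrorModel p k) :
    Xi p q k
  | .mu j r => ∫ ω, S.Xstar M 0 j ω r ∂P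
  | .sig j l r s => cov[fun ω => S.Xstar M 0 j ω r, fun ω => S.Xstar M 0 l ω s; P]
  | .muZ a => ∫ ω, S.Z 0 ω a ∂P
  | .sigZZ a b => cov[fun ω => S.Z 0 ω a, fun ω => S.Z 0 ω b; P]
  | .sigZXstar j a r => cov[fun ω => S.Z 0 ω a, fun ω => S.Xstar M 0 j ω r; P]
  | .muX r => ∫ ω, S.X 0 ω r ∂P
  | .sigXX r s => cov[fun ω => S.X 0 ω r, fun ω => S.X 0 ω s; P]
  | .sigZX a r => cov[fun ω => S.Z 0 ω a, fun ω => S.X 0 ω r; P]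
  | .eta0 j r => M.eta0 j r
  | .eta1 j r s => Matrix.diagonal (M.eta1 j) r s
  | .errVar j r s =>
      match M.kind j with
      | .additive => cov[fun ω => S.err 0 j ω r, fun ω => S.err 0 j ω s; P]
      | .multiplicative => M.eta1 j r *
          ((∫ ω, S.X 0 ω r * S.X 0 ω s ∂P) *
            cov[fun ω => S.err 0 j ω r, fun ω => S.err 0 j ω s; P]) * M.eta1 j s
  | .sigXXstar j r s => cov[fun ω => S.X 0 ω r, fun ω => S.Xstar M 0 j ω s; P]

/-- The conditions under which the divisions, inverses and square roots in the chosen family of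
correction parameter estimators are legitimate at the true parameters. -/
structure Identifiable [MeasurableSpace Ω] (c : Scheme) (P : Measure Ω) (S : Subjects Ω p q k)
    (M : ErrorModel p k) : Prop where
  two_le : 2 ≤ k
  J0_nonempty : M.J0.Nonempty
  J1_nonempty : M.J1.Nonempty
  eta1_ne_zero : ∀ j r, M.eta1 j r ≠ 0
  of_proxies : c = .proxies → 1 < M.J1.card ∧ (trueXi P S M).sigXX.det ≠ 0
  of_covariates : c = .covariates →
    (∀ j r, 0 < M.eta1 j r) ∧ ∀ r, ∃ a, (trueXi P S M).sigZX a r ≠ 0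

/-! ### The best linear unbiased predictor -/

/-- How the weights `αⱼ` that combine the proxies are obtained: they are prescribed, or they are
chosen together with the coefficients of the predictor. -/
inductive Weighting (k : ℕ)
  | fixed (a : Fin k → ℝ)
  | optimal

/-- The coordinates of the parameter `τ = (μ, β, γ, α, λ)` of the predictor
`x̂ = μ + β ∑ⱼ αⱼ x*ⱼ + γ z`; here `λ` is the Lagrange multiplier of the constraint `∑ⱼ αⱼ = 1`. -/
inductive TauIdx (p q k : ℕ)
  | mu (r : Fin p)
  | beta (r s : Fin p)
  | gamma (r : Fin p) (a : Fin q)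
  | alpha (j : Fin k)
  | lam
  deriving DecidableEq, Fintype

/-- The space of predictor parameters. -/
abbrev Tau (p q k : ℕ) : Type := TauIdx p q k → ℝ

namespace Tau

def mu (τ : Tau p q k) : Fin p → ℝ := fun r => τ (.mu r)
def beta (τ : Tau p q k) : Matrix (Fin p) (Fin p) ℝ := .of fun r s => τ (.beta r s)
def gamma (τ : Tau p q k) : Matrix (Fin p) (Fin q) ℝ := .of fun r a => τ (.gamma r a)
def alpha (τ : Tau p q k) : Fin k → ℝ := fun j => τ (.alpha j)
def lam (τ : Tau p q k) : ℝ := τ .lam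

end Tau

/-- The predictor `x̂ = μ + β ∑ⱼ αⱼ x*ⱼ + γ z`. -/
def predictor (τ : Tau p q k) (x : Fin k → Fin p → ℝ) (z : Fin q → ℝ) : Fin p → ℝ :=
  τ.mu + τ.beta *ᵥ (∑ j, τ.alpha j • x j) + τ.gamma *ᵥ z

/-- The weights are nonnegative, sum to one, and agree with the prescribed ones, if any. -/
def Admissible (w : Weighting k) (a : Fin k → ℝ) : Prop :=
  a ∈ stdSimplex ℝ (Fin k) ∧
    match w with
    | .fixed a₀ => a = a₀
    | .optimal => True

/-- The mean squared error `E‖X - X̂‖²` of the predictor. -/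
def mse [MeasurableSpace Ω] (P : Measure Ω) (S : Subjects Ω p q k) (M : ErrorModel p k)
    (τ : Tau p q k) : ℝ :=
  ∫ ω, ∑ r, (S.X 0 ω r - predictor τ (fun j => S.Xstar M 0 j ω) (S.Z 0 ω) r) ^ 2 ∂P

/-- `τ` is the parameter of the best linear unbiased predictor: it minimizes the mean squared error
among all predictors with admissible weights. (The multiplier of `∑ⱼ αⱼ = 1` is zero, because
the scale of the weights can be absorbed in `β`.) -/
structure IsBLUP [MeasurableSpace Ω] (w : Weighting k) (P : Measure Ω) (S : Subjects Ω p q k)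
    (M : ErrorModel p k) (τ : Tau p q k) : Prop where
  admissible : Admissible w τ.alpha
  lam_eq : τ.lam = 0
  minimal : ∀ τ' : Tau p q k, Admissible w τ'.alpha → mse P S M τ ≤ mse P S M τ'

/-- `cov(X - X̂, X*ⱼ) = Σ_{XX*ⱼ} - β ∑ₗ αₗ Σ_{X*ₗX*ⱼ} - γ Σ_{ZX*ⱼ}` as a function of the parameters. -/
def residCov (τ : Tau p q k) (ξ : Xi p q k) (j : Fin k) : Matrix (Fin p) (Fin p) ℝ :=
  ξ.sigXXstar j - τ.beta * (∑ l, τ.alpha l • ξ.sig l j) - τ.gamma * ξ.sigZXstar j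

/-- The estimating function `h` of the predictor parameters: the first-order conditions for
minimizing the mean squared error, written through the correction parameters `ξ`. -/
def hFun (w : Weighting k) (τ : Tau p q k) (ξ : Xi p q k) : TauIdx p q k → ℝ
  | .mu r => (ξ.muX - τ.mu - τ.beta *ᵥ (∑ j, τ.alpha j • ξ.mu j) - τ.gamma *ᵥ ξ.muZ) r
  | .beta r s => (∑ j, τ.alpha j • residCov τ ξ j) r s
  | .gamma r a =>
      (ξ.sigZXᵀ - τ.beta * (∑ j, τ.alpha j • (ξ.sigZXstar j)ᵀ) - τ.gamma * ξ.sigZZ) r a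
  | .alpha j =>
      match w with
      | .fixed a₀ => τ.alpha j - a₀ j
      | .optimal => (τ.betaᵀ * residCov τ ξ j).trace - τ.lam
  | .lam =>
      match w with
      | .fixed _ => τ.lam
      | .optimal => ∑ j, τ.alpha j - 1

/-! ### The stacked estimating equation and the sandwich covariance -/

/-- Coordinates of the stacked parameter `(Θ, τ, ξ)`. -/
abbrev Idx (m p q k : ℕ) : Type := Fin m ⊕ TauIdx p q k ⊕ XiIdx p q k

/-- An estimating function `Ψ(y, x, z; Θ)` for a parameter `Θ` in `ℝ^m`. -/
abbrev Score (p q m : ℕ) : Type := ℝ → (Fin p → ℝ) → (Fin q → ℝ) → (Fin m → ℝ) → Fin m → ℝ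

/-- The outcome estimating function with the true covariate replaced by its predictor. -/
def rcScore (Ψ : Score p q m) (o : Obs p q k) (Θ : Fin m → ℝ) (τ : Tau p q k) : Fin m → ℝ :=
  Ψ o.1 (predictor τ o.2.1 o.2.2) o.2.2 Θ

/-- Stacking of `Θ`, `τ` and `ξ`. -/
def stack (Θ : Fin m → ℝ) (τ : Tau p q k) (ξ : Xi p q k) : Idx m p q k → ℝ :=
  Sum.elim Θ (Sum.elim τ ξ)

/-- The stacked estimating function `(Ψ, h, g)` of one observation. -/
def stackedFun (c : Scheme) (w : Weighting k) (M : ErrorModel p k) (Ψ : Score p q m)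
    (o : Obs p q k) (θ : Idx m p q k → ℝ) : Idx m p q k → ℝ :=
  let Θ : Fin m → ℝ := fun i => θ (.inl i)
  let τ : Tau p q k := fun t => θ (.inr (.inl t))
  let ξ : Xi p q k := fun t => θ (.inr (.inr t))
  stack (rcScore Ψ o Θ τ) (hFun w τ ξ) (gFun c M o.2.1 o.2.2 ξ)

/-- `A`, the expected Jacobian of the stacked estimating function at `θ`. -/
def matA (c : Scheme) (w : Weighting k) (M : ErrorModel p k) (Ψ : Score p q m)
    (L : Measure (Obs p q k)) (θ : Idx m p q k → ℝ) : Matrix (Idx m p q k) (Idx m p q k) ℝ :=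
  .of fun a b => ∫ o, fderiv ℝ (fun θ' => stackedFun c w M Ψ o θ' a) θ (Pi.single b 1) ∂L

/-- `B`, the expected outer product of the stacked estimating function at `θ`. -/
def matB (c : Scheme) (w : Weighting k) (M : ErrorModel p k) (Ψ : Score p q m)
    (L : Measure (Obs p q k)) (θ : Idx m p q k → ℝ) : Matrix (Idx m p q k) (Idx m p q k) ℝ :=
  .of fun a b => ∫ o, stackedFun c w M Ψ o θ a * stackedFun c w M Ψ o θ b ∂L

/-- `Q = [I 0]`, the projection on the `Θ` coordinates. -/
def matQ (m p q k : ℕ) : Matrix (Fin m) (Idx m p q k) ℝ :=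
  .of fun i b => if b = .inl i then 1 else 0

/-- The sandwich `Q A⁻¹ B A⁻ᵀ Qᵀ`. -/
def sandwich (A B : Matrix (Idx m p q k) (Idx m p q k) ℝ) : Matrix (Fin m) (Fin m) ℝ :=
  matQ m p q k * A⁻¹ * B * (A⁻¹)ᵀ * (matQ m p q k)ᵀ

/-- `A_RC`: the matrix `A` at `(Θ, τ, ξ₀)`, with `ξ₀` the true correction parameters. -/
def ARC [MeasurableSpace Ω] (c : Scheme) (w : Weighting k) (P : Measure Ω)
    (S : Subjects Ω p q k) (M : ErrorModel p k) (Ψ : Score p q m)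
    (Θ : Fin m → ℝ) (τ : Tau p q k) : Matrix (Idx m p q k) (Idx m p q k) ℝ :=
  matA c w M Ψ (S.obsLaw M P) (stack Θ τ (trueXi P S M))

/-- `B_RC`: the matrix `B` at `(Θ, τ, ξ₀)`, with `ξ₀` the true correction parameters. -/
def BRC [MeasurableSpace Ω] (c : Scheme) (w : Weighting k) (P : Measure Ω)
    (S : Subjects Ω p q k) (M : ErrorModel p k) (Ψ : Score p q m)
    (Θ : Fin m → ℝ) (τ : Tau p q k) : Matrix (Idx m p q k) (Idx m p q k) ℝ :=
  matB c w M Ψ (S.obsLaw M P) (stack Θ τ (trueXi P S M))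

/-- The regularity conditions. `KΘ` and `Kτ` are the parameter sets for `Θ` and `τ`. -/
structure RegularityConditions [MeasurableSpace Ω] (c : Scheme) (w : Weighting k) (P : Measure Ω)
    (S : Subjects Ω p q k) (M : ErrorModel p k) (Ψ : Score p q m)
    (KΘ : Set (Fin m → ℝ)) (Kτ : Set (Tau p q k))
    (Θ₀ : Fin m → ℝ) (τ₀ : Tau p q k) : Prop where
  /-- Fourth moments are finite. -/
  memLp_X : ∀ r, MemLp (fun ω => S.X 0 ω r) 4 P
  memLp_Z : ∀ a, MemLp (fun ω => S.Z 0 ω a) 4 P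
  memLp_err : ∀ j r, MemLp (fun ω => S.err 0 j ω r) 4 P
  /-- Compact parameter sets that contain the limits. -/
  compact_Θ : IsCompact KΘ
  compact_τ : IsCompact Kτ
  mem_Θ : Θ₀ ∈ KΘ
  mem_τ : τ₀ ∈ Kτ
  /-- Weights that are estimated have their limit in the interior of the simplex. -/
  alpha_pos : w = .optimal → ∀ j, 0 < τ₀.alpha j
  /-- The population equations have no other root in the parameter sets. -/
  unique_Θ : ∀ Θ ∈ KΘ, ∫ o, rcScore Ψ o Θ τ₀ ∂(S.obsLaw M P) = 0 → Θ = Θ₀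
  unique_τ : ∀ τ ∈ Kτ, hFun w τ (trueXi P S M) = 0 → τ = τ₀
  /-- The outcome estimating function is measurable in the data and, along the predictor, it is
  continuous and dominated on the parameter set, and continuously differentiable with dominated
  derivative near the limit. -/
  measurable_Ψ : ∀ Θ, Measurable fun d : ℝ × (Fin p → ℝ) × (Fin q → ℝ) => Ψ d.1 d.2.1 d.2.2 Θ
  smooth_Ψ : ∃ W : Set (Fin m → ℝ), ∃ V : Set (Tau p q k), ∃ F : Obs p q k → ℝ,
    IsOpen W ∧ IsOpen V ∧ Θ₀ ∈ W ∧ τ₀ ∈ V ∧ Integrable F (S.obsLaw M P) ∧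
    ∀ᵐ o ∂(S.obsLaw M P),
      ContinuousOn (fun t : (Fin m → ℝ) × Tau p q k => rcScore Ψ o t.1 t.2) (KΘ ×ˢ V) ∧
      (∀ Θ ∈ KΘ, ∀ τ ∈ V, ‖rcScore Ψ o Θ τ‖ ≤ F o) ∧
      ContDiffOn ℝ 1 (fun t : (Fin m → ℝ) × Tau p q k => rcScore Ψ o t.1 t.2) (W ×ˢ V) ∧
      ∀ t ∈ W ×ˢ V,
        ‖fderiv ℝ (fun t : (Fin m → ℝ) × Tau p q k => rcScore Ψ o t.1 t.2) t‖ ≤ F o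
  /-- The outcome estimating function has finite second moments at the limit. -/
  memLp_Ψ : MemLp (fun o => rcScore Ψ o Θ₀ τ₀) 2 (S.obsLaw M P)
  /-- The expected Jacobian is nonsingular. -/
  det_A : (ARC c w P S M Ψ Θ₀ τ₀).det ≠ 0

/-- The regression calibration estimator: with probability tending to one, `(Θ̂ₙ, τ̂ₙ, ξ̂ₙ)` solves
the stacked empirical estimating equation of the first `n` subjects within the parameter sets. -/
def IsRCEstimator [MeasurableSpace Ω] (c : Scheme) (w : Weighting k) (P : Measure Ω)
    (S : Subjects Ω p q k) (M : ErrorModel p k) (Ψ : Score p q m)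
    (KΘ : Set (Fin m → ℝ)) (Kτ : Set (Tau p q k))
    (Θhat : ℕ → Ω → Fin m → ℝ) (τhat : ℕ → Ω → Tau p q k) (ξhat : ℕ → Ω → Xi p q k) : Prop :=
  Tendsto (fun n : ℕ => P {ω | ¬ (Θhat n ω ∈ KΘ ∧ τhat n ω ∈ Kτ ∧
    (n : ℝ)⁻¹ • ∑ i ∈ Finset.range n,
      stackedFun c w M Ψ (S.obs M i ω) (stack (Θhat n ω) (τhat n ω) (ξhat n ω)) = 0)})
    atTop (𝓝 0)

end RC

end

/-! The estimator is a root of a stacked estimating equation. Two facts give the limit law: the root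
is consistent, and the stacked function is differentiable in mean at the true parameter.

Consistency uses the triangular structure. The equations for `ξ` involve neither `Θ` nor `τ`. Sample
moments converge by the law of large numbers, and every other coordinate is a continuous function of
coordinates already shown to converge (`tendsto_of_sampleMean_gFun_eq_zero`). That the limit is the
true value is covariance algebra: each proxy is an affine function of `X` plus a noise uncorrelated
with `X`, `Z` and the noises of the other proxies. Hence `cov(X*ⱼ, X*ₗ) = Hⱼ Σ_XX Hₗ` for `j ≠ l`,
and this makes both schemes correct (`eta1Formula_trueXi`, `sigXXstarFormula_trueXi`). Given `ξ`,
compactness handles `τ` and then `Θ`: every cluster point solves the limiting equation, whose root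
is unique (`tendsto_of_hFun_eq_zero`, `tendsto_of_sampleMean_eq_zero`).

For normality, the first-order remainder is at most `w(y) ‖θ - θ₀‖` near `θ₀`, with `∫ w` as small
as desired. With `Sₙ` the sample mean of `ψ(θ₀)`, the law of large numbers turns the equation into
`0 = Sₙ + A(θ̂ - θ₀) + o(‖θ̂ - θ₀‖)` (`isLittleO_sampleMean_sub`). Since `A` is invertible the error
is also `o(‖Sₙ‖)`, and `√n Sₙ` is bounded in probability, so `√n(θ̂ - θ₀) = -A⁻¹ √n Sₙ + o(1)`
(`tendsto_sqrt_smul_estimator_add`). The central limit theorem for `-Q A⁻¹ ψ(θ₀)`, whose second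
moment matrix is the sandwich, and Slutsky's theorem finish the proof.

Convergence in probability is encoded by the filter `inProbability`, so that Landau symbols,
continuity and ultrafilters apply to it directly. It is built from outer probabilities, so `τ̂` and
`ξ̂` need no measurability. -/

noncomputable section

namespace RC

/-! ### Convergence in probability as convergence along a filter -/

section InProbability

variable {Ω : Type*} [MeasurableSpace Ω] {P : Measure Ω}

/-- The filter of the sets `A ⊆ ℕ × Ω` for which the outer probability of `{ω | (n, ω) ∉ A}` tends
to zero as `n → ∞`. Convergence along it is convergence in probability. -/
def inProbability (P : Measure Ω) : Filter (ℕ × Ω) where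
  sets := {A | Tendsto (fun n => P {ω | (n, ω) ∉ A}) atTop (𝓝 0)}
  univ_sets := by simp
  sets_of_superset := by
    intro A B hA hAB
    refine tendsto_of_tendsto_of_tendsto_of_le_of_le tendsto_const_nhds hA (fun _ => zero_le)
      fun n => measure_mono fun ω hω h => hω (hAB h)
  inter_sets := by
    intro A B hA hB
    have h := Tendsto.add hA hB
    rw [add_zero] at h
    refine tendsto_of_tendsto_of_tendsto_of_le_of_le tendsto_const_nhds h (fun _ => zero_le)
      fun n => ?_
    refine le_trans (measure_mono fun ω hω => ?_) (measure_union_le _ _)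
    by_contra hcon
    simp only [Set.mem_union, Set.mem_ofPred_eq, not_or, not_not] at hcon
    exact hω hcon

theorem eventually_inProbability {p : ℕ × Ω → Prop} :
    (∀ᶠ x in inProbability P, p x) ↔ Tendsto (fun n => P {ω | ¬ p (n, ω)}) atTop (𝓝 0) :=
  Iff.rfl

/-- The total mass is one for every `n`, so it cannot tend to zero. Uniqueness of limits along the
filter depends on this. -/
instance [IsProbabilityMeasure P] : (inProbability P).NeBot := by
  refine ⟨fun h => ?_⟩
  have h0 : ∀ᶠ _ in inProbability P, False := by rw [h]; simp
  rw [eventually_inProbability] at h0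
  simp only [not_false_eq_true, Set.ofPred_true, measure_univ] at h0
  exact one_ne_zero (tendsto_nhds_unique tendsto_const_nhds h0)

theorem tendsto_inProbability_iff {E : Type*} [PseudoMetricSpace E] {f : ℕ → Ω → E} {c : E} :
    Tendsto (fun x : ℕ × Ω => f x.1 x.2) (inProbability P) (𝓝 c) ↔
      TendstoInMeasure P f atTop fun _ => c := by
  rw [tendstoInMeasure_iff_dist, Metric.tendsto_nhds]
  simp [eventually_inProbability]

theorem eventually_inProbability_of_atTop {p : ℕ → Prop} (h : ∀ᶠ n in atTop, p n) :
    ∀ᶠ x in inProbability P, p x.1 := by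
  rw [eventually_inProbability]
  refine tendsto_const_nhds.congr' ?_
  filter_upwards [h] with n hn
  simp [hn]

theorem eventually_inProbability_of_ae {p : Ω → Prop} (h : ∀ᵐ ω ∂P, p ω) :
    ∀ᶠ x in inProbability P, p x.2 := by
  rw [eventually_inProbability]
  refine tendsto_const_nhds.congr fun n => ?_
  exact (ae_iff.1 h).symm

/-- Uniform tightness of a sequence of random elements of a normed space. -/
def BoundedInProbability {E : Type*} [Norm E] (P : Measure Ω) (v : ℕ × Ω → E) : Prop :=
  ∀ η : ENNReal, 0 < η → ∃ C : ℝ, 0 < C ∧ ∀ n, P {ω | C ≤ ‖v (n, ω)‖} ≤ η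

theorem BoundedInProbability.pi {ι : Type*} [Fintype ι] {v : ℕ × Ω → ι → ℝ}
    (h : ∀ a, BoundedInProbability P fun x => v x a) : BoundedInProbability P v := by
  intro η hη
  -- The added one keeps the denominator nonzero when `ι` is empty; the one in the threshold below
  -- serves the same purpose.
  have hη' : 0 < η / (Fintype.card ι + 1) :=
    ENNReal.div_pos hη.ne' (by finiteness)
  choose C hC0 hC using fun a => h a _ hη'
  refine ⟨1 + ∑ a, C a, add_pos_of_pos_of_nonneg one_pos
    (Finset.sum_nonneg fun a _ => (hC0 a).le), fun n => ?_⟩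
  have hle (a : ι) : C a ≤ 1 + ∑ a, C a := by
    have := Finset.single_le_sum (f := C) (fun a _ => (hC0 a).le) (Finset.mem_univ a)
    linarith
  have hsub : {ω | 1 + ∑ a, C a ≤ ‖v (n, ω)‖} ⊆ ⋃ a, {ω | C a ≤ ‖v (n, ω) a‖} := by
    intro ω hω
    by_contra hcon
    simp only [Set.mem_iUnion, Set.mem_ofPred_eq, not_exists, not_le] at hcon
    refine absurd (show 1 + ∑ a, C a ≤ ‖v (n, ω)‖ from hω) (not_le.2 ?_)
    rw [pi_norm_lt_iff (add_pos_of_pos_of_nonneg one_pos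
      (Finset.sum_nonneg fun a _ => (hC0 a).le))]
    exact fun a => (hcon a).trans_le (hle a)
  calc P {ω | 1 + ∑ a, C a ≤ ‖v (n, ω)‖} ≤ ∑ a, P {ω | C a ≤ ‖v (n, ω) a‖} :=
        (measure_mono hsub).trans (measure_iUnion_fintype_le _ _)
    _ ≤ ∑ _a : ι, η / (Fintype.card ι + 1) := Finset.sum_le_sum fun a _ => hC a n
    _ = Fintype.card ι * (η / (Fintype.card ι + 1)) := by simp
    _ ≤ (Fintype.card ι + 1) * (η / (Fintype.card ι + 1)) := by gcongr; exact le_self_add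
    _ = η := ENNReal.mul_div_cancel (by simp) (by finiteness)

/-- Outside an event of small probability `‖v‖ < C`, and there the little-o bound with a constant
proportional to `ε / C` makes `u` smaller than `ε`. -/
theorem tendsto_zero_of_isLittleO {E F : Type*} [NormedAddCommGroup E] [NormedAddCommGroup F]
    {u : ℕ × Ω → E} {v : ℕ × Ω → F} (huv : u =o[inProbability P] v)
    (hv : BoundedInProbability P v) : Tendsto u (inProbability P) (𝓝 0) := by
  rw [Metric.tendsto_nhds]
  intro ε hε
  rw [eventually_inProbability, ENNReal.tendsto_nhds_zero]
  intro η hη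
  obtain ⟨C, hC, hCn⟩ := hv (η / 2) (ENNReal.half_pos hη.ne')
  have h := huv.def (c := ε / (2 * C)) (by positivity)
  rw [eventually_inProbability, ENNReal.tendsto_nhds_zero] at h
  filter_upwards [h (η / 2) (ENNReal.half_pos hη.ne')] with n hn
  calc P {ω | ¬ dist (u (n, ω)) 0 < ε}
      ≤ P ({ω | ¬ ‖u (n, ω)‖ ≤ ε / (2 * C) * ‖v (n, ω)‖} ∪ {ω | C ≤ ‖v (n, ω)‖}) := by
        refine measure_mono fun ω hω => ?_
        by_contra hcon
        simp only [Set.mem_union, Set.mem_ofPred_eq, not_or, not_le] at hcon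
        refine hω ?_
        rw [dist_zero_right]
        refine (not_lt.1 hcon.1).trans_lt ?_
        calc ε / (2 * C) * ‖v (n, ω)‖ < ε / (2 * C) * (2 * C) := by gcongr; linarith [hcon.2]
          _ = ε := by field_simp
    _ ≤ η / 2 + η / 2 := (measure_union_le _ _).trans (add_le_add hn (hCn n))
    _ = η := ENNReal.add_halves η

end InProbability

/-! ### Independent and identically distributed samples -/

section SampleMean

variable {Ω O : Type*} {o : ℕ → Ω → O}

/-- The mean of `f` over the first `n` observations. -/
def sampleMean {E : Type*} [AddCommGroup E] [Module ℝ E] (o : ℕ → Ω → O) (f : O → E)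
    (x : ℕ × Ω) : E :=
  (x.1 : ℝ)⁻¹ • ∑ i ∈ Finset.range x.1, f (o i x.2)

theorem sampleMean_add (f g : O → ℝ) (x : ℕ × Ω) :
    sampleMean o (fun y => f y + g y) x = sampleMean o f x + sampleMean o g x := by
  simp [sampleMean, Finset.sum_add_distrib, mul_add]

theorem sampleMean_sub (f g : O → ℝ) (x : ℕ × Ω) :
    sampleMean o (fun y => f y - g y) x = sampleMean o f x - sampleMean o g x := by
  simp [sampleMean, Finset.sum_sub_distrib, mul_sub]

theorem sampleMean_mul_const (f : O → ℝ) (c : ℝ) (x : ℕ × Ω) :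
    sampleMean o (fun y => f y * c) x = sampleMean o f x * c := by
  simp [sampleMean, Finset.sum_mul, mul_assoc]

theorem sampleMean_const_mul (f : O → ℝ) (c : ℝ) (x : ℕ × Ω) :
    sampleMean o (fun y => c * f y) x = c * sampleMean o f x := by
  simp only [mul_comm c, sampleMean_mul_const]

theorem sampleMean_sum {ι : Type*} (s : Finset ι) (f : ι → O → ℝ) (x : ℕ × Ω) :
    sampleMean o (fun y => ∑ b ∈ s, f b y) x = ∑ b ∈ s, sampleMean o (f b) x := by
  simp only [sampleMean, smul_eq_mul, Finset.mul_sum]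
  rw [Finset.sum_comm]

/-- The empty sample has mean zero whatever `c` is, so sample size zero has to be excluded. -/
theorem sampleMean_const {c : ℝ} {x : ℕ × Ω} (hx : x.1 ≠ 0) :
    sampleMean o (fun _ => c) x = c := by
  simp [sampleMean, hx]

theorem sampleMean_apply {ι : Type*} (f : O → ι → ℝ) (x : ℕ × Ω) (a : ι) :
    sampleMean o f x a = sampleMean o (fun y => f y a) x := by
  simp [sampleMean]

theorem abs_sampleMean_le {f g : O → ℝ} {x : ℕ × Ω} (h : ∀ i, |f (o i x.2)| ≤ g (o i x.2)) :
    |sampleMean o f x| ≤ sampleMean o g x := by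
  simp only [sampleMean, smul_eq_mul, abs_mul]
  rw [abs_of_nonneg (by positivity : (0 : ℝ) ≤ (x.1 : ℝ)⁻¹)]
  gcongr
  exact (Finset.abs_sum_le_sum_abs _ _).trans (Finset.sum_le_sum fun i _ => h i)

end SampleMean

section Sample

variable {Ω O : Type*} [MeasurableSpace Ω] [MeasurableSpace O] {P : Measure Ω}
  {o : ℕ → Ω → O} {L : Measure O}

/-- `o 0, o 1, …` is a sequence of independent random elements with law `L`. -/
structure IsIIDSample (P : Measure Ω) (o : ℕ → Ω → O) (L : Measure O) : Prop where
  measurable : ∀ i, Measurable (o i)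
  indep : iIndepFun o P
  map_eq : ∀ i, P.map (o i) = L

theorem IsIIDSample.identDistrib (h : IsIIDSample P o L) {E : Type*} [MeasurableSpace E]
    {f : O → E} (hf : AEMeasurable f L) (i : ℕ) :
    IdentDistrib (fun ω => f (o i ω)) (fun ω => f (o 0 ω)) P P := by
  have hi (i : ℕ) : AEMeasurable f (P.map (o i)) := by rwa [h.map_eq]
  refine ⟨(hi i).comp_measurable (h.measurable i), (hi 0).comp_measurable (h.measurable 0), ?_⟩
  have hm (i : ℕ) : P.map (fun ω => f (o i ω)) = L.map f := by
    have h1 := AEMeasurable.map_map_of_aemeasurable (hi i) (h.measurable i).aemeasurable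
    rw [h.map_eq] at h1
    exact h1.symm
  rw [hm, hm]

theorem IsIIDSample.iIndepFun_comp (h : IsIIDSample P o L) {E : Type*} [MeasurableSpace E]
    {f : O → E} (hf : AEMeasurable f L) : iIndepFun (fun i ω => f (o i ω)) P :=
  h.indep.comp₀ (fun _ => f) (fun i => (h.measurable i).aemeasurable)
    fun i => by rwa [h.map_eq]

theorem IsIIDSample.ae (h : IsIIDSample P o L) {p : O → Prop} (hp : ∀ᵐ y ∂L, p y) :
    ∀ᵐ ω ∂P, ∀ i, p (o i ω) := by
  rw [ae_all_iff]
  intro i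
  rw [← h.map_eq i] at hp
  exact ae_of_ae_map (h.measurable i).aemeasurable hp

theorem IsIIDSample.integral_comp (h : IsIIDSample P o L) {E : Type*} [NormedAddCommGroup E]
    [NormedSpace ℝ E] {f : O → E} (hf : AEStronglyMeasurable f L) :
    ∫ ω, f (o 0 ω) ∂P = ∫ y, f y ∂L := by
  have hf' : AEStronglyMeasurable f (P.map (o 0)) := by rwa [h.map_eq]
  rw [← integral_map (h.measurable 0).aemeasurable hf', h.map_eq]

theorem IsIIDSample.memLp_comp (h : IsIIDSample P o L) {f : O → ℝ} {r : ENNReal}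
    (hf : MemLp f r L) (i : ℕ) : MemLp (fun ω => f (o i ω)) r P := by
  rw [← h.map_eq i] at hf
  exact hf.comp_of_map (h.measurable i).aemeasurable

/-- The law of large numbers along the filter `inProbability`. -/
theorem IsIIDSample.tendsto_sampleMean [IsProbabilityMeasure P] (h : IsIIDSample P o L)
    {f : O → ℝ} (hf : Integrable f L) :
    Tendsto (sampleMean o f) (inProbability P) (𝓝 (∫ y, f y ∂L)) := by
  have hfm := hf.aestronglyMeasurable.aemeasurable
  have hint (i : ℕ) : Integrable (fun ω => f (o i ω)) P :=
    memLp_one_iff_integrable.1 (h.memLp_comp (memLp_one_iff_integrable.2 hf) i)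
  have hlim := strong_law_ae_real (fun i ω => f (o i ω)) (hint 0)
    (fun i j hij => (h.iIndepFun_comp hfm).indepFun hij) (h.identDistrib hfm)
  rw [h.integral_comp hf.aestronglyMeasurable] at hlim
  have := tendstoInMeasure_of_tendsto_ae (μ := P)
    (f := fun n ω => sampleMean o f (n, ω)) (g := fun _ => ∫ y, f y ∂L) (fun n => ?_) ?_
  · exact (tendsto_inProbability_iff (f := fun n ω => sampleMean o f (n, ω))).2 this
  · simp only [sampleMean]
    exact AEStronglyMeasurable.const_smul (Finset.aestronglyMeasurable_fun_sum _ fun i _ =>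
      (hint i).aestronglyMeasurable) (n : ℝ)⁻¹
  · filter_upwards [hlim] with ω hω
    simpa [sampleMean, div_eq_inv_mul] using hω

/-- Chebyshev's inequality: by independence the variance of the scaled mean is the variance of one
summand, uniformly in `n`. -/
theorem IsIIDSample.boundedInProbability [IsProbabilityMeasure P] (h : IsIIDSample P o L)
    {f : O → ℝ} (hf : MemLp f 2 L) (h0 : ∫ y, f y ∂L = 0) :
    BoundedInProbability P fun x => √(x.1 : ℝ) * sampleMean o f x := by
  have hfm := hf.aestronglyMeasurable.aemeasurable
  have hL2 (i : ℕ) := h.memLp_comp hf i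
  set v : ℝ := Var[fun ω => f (o 0 ω); P] with hv
  have hv0 : 0 ≤ v := variance_nonneg _ _
  have hmean (i : ℕ) : ∫ ω, f (o i ω) ∂P = 0 := by
    rw [(h.identDistrib hfm i).integral_eq, h.integral_comp hf.aestronglyMeasurable, h0]
  have key (n : ℕ) (C : ℝ) (hC : 0 < C) :
      P {ω | C ≤ ‖√(n : ℝ) * sampleMean o f (n, ω)‖} ≤ ENNReal.ofReal (v / C ^ 2) := by
    set Sn : Ω → ℝ := fun ω => √(n : ℝ) * sampleMean o f (n, ω) with hSn
    have hS : Sn = fun ω => (√(n : ℝ) * (n : ℝ)⁻¹) * ∑ i ∈ Finset.range n, f (o i ω) := by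
      ext ω; simp [hSn, sampleMean, mul_assoc]
    have hmem : MemLp Sn 2 P := by
      rw [hS]
      exact (memLp_finsetSum (Finset.range n) fun i _ => hL2 i).const_mul _
    have hmS : ∫ ω, Sn ω ∂P = 0 := by
      rw [hS, integral_const_mul, integral_finsetSum _ fun i _ => (hL2 i).integrable (by simp)]
      simp [hmean]
    have hvar : Var[Sn; P] ≤ v := by
      rw [hS, variance_const_mul]
      have hsum : Var[fun ω => ∑ i ∈ Finset.range n, f (o i ω); P] = n * v := by
        have := IndepFun.variance_sum (μ := P) (X := fun i ω => f (o i ω)) (s := Finset.range n)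
          (fun i _ => hL2 i) (fun i _ j _ hij => (h.iIndepFun_comp hfm).indepFun hij)
        rw [show (fun ω => ∑ i ∈ Finset.range n, f (o i ω)) =
          ∑ i ∈ Finset.range n, fun ω => f (o i ω) by ext; simp, this]
        simp only [(h.identDistrib hfm _).variance_eq, ← hv]
        simp
      rw [hsum, mul_pow, Real.sq_sqrt (by positivity)]
      -- Only an inequality is available at `n = 0`, where the scaled mean is identically zero.
      rcases Nat.eq_zero_or_pos n with rfl | hn
      · simpa using hv0
      · have : (n : ℝ) ≠ 0 := by positivity
        apply le_of_eq
        field_simp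
    have := meas_ge_le_variance_div_sq hmem hC
    rw [hmS] at this
    simp only [sub_zero] at this
    refine this.trans (ENNReal.ofReal_le_ofReal ?_)
    gcongr
  intro η hη
  rcases eq_or_ne η ⊤ with rfl | hη'
  · exact ⟨1, one_pos, fun n => le_top⟩
  have hηr : 0 < η.toReal := ENNReal.toReal_pos hη.ne' hη'
  -- Chebyshev gives `v / C² ≤ η` for this `C`; using `v + 1` keeps `C` positive when the variance
  -- vanishes.
  refine ⟨√((v + 1) / η.toReal), by positivity, fun n => ?_⟩
  refine (key n _ (by positivity)).trans ?_
  rw [Real.sq_sqrt (by positivity), ← ENNReal.ofReal_toReal hη']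
  refine ENNReal.ofReal_le_ofReal ?_
  rw [ENNReal.toReal_ofReal hηr.le, div_le_iff₀ (by positivity), mul_div_cancel₀ _ hηr.ne']
  linarith

end Sample

/-! ### Dominated moduli of continuity -/

section Modulus

variable {O : Type*} [MeasurableSpace O] {L : Measure O}

/-- A dominated family of functions that vanish continuously at a point is, near that point,
bounded by a function of small integral. -/
theorem exists_integrable_modulus {T : Type*} [PseudoMetricSpace T] [SecondCountableTopology T]
    {f : O → T → ℝ} {F : O → ℝ} {s : Set T} {t₀ : T} (hF : Integrable F L)
    (hmeas : ∀ t ∈ s, AEMeasurable (fun y => f y t) L)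
    (hae : ∀ᵐ y ∂L, ContinuousOn (f y) s ∧ (∀ t ∈ s, f y t ≤ F y) ∧
      Tendsto (f y) (𝓝[s] t₀) (𝓝 0)) {ε : ℝ} (hε : 0 < ε) :
    ∃ δ > 0, ∃ w : O → ℝ, (∀ y, 0 ≤ w y) ∧ Integrable w L ∧
    ∫ y, w y ∂L ≤ ε ∧ ∀ᵐ y ∂L, ∀ t ∈ s, dist t t₀ < δ → f y t ≤ w y := by
  obtain ⟨D, hDs, hDc, hD⟩ :=
    (TopologicalSpace.IsSeparable.of_separableSpace s).exists_countable_dense_subset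
  let r : ℕ → ℝ := fun n => 1 / ((n : ℝ) + 1)
  have hr (n : ℕ) : 0 < r n := by positivity
  -- The supremum runs over a countable dense subset, so it is measurable; continuity will extend
  -- the bound to all of `s`.
  let w : ℕ → O → ENNReal := fun n y => ⨆ t ∈ D ∩ Metric.ball t₀ (r n), ENNReal.ofReal (f y t)
  have hwm (n : ℕ) : AEMeasurable (w n) L :=
    AEMeasurable.biSup _ (hDc.mono Set.inter_subset_left) fun t ht =>
      (hmeas t (hDs ht.1)).ennreal_ofReal
  have hwF (n : ℕ) : w n ≤ᵐ[L] fun y => ENNReal.ofReal (F y) := by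
    filter_upwards [hae] with y hy
    exact iSup₂_le fun t ht => ENNReal.ofReal_le_ofReal (hy.2.1 t (hDs ht.1))
  have hFfin : ∫⁻ y, ENNReal.ofReal (F y) ∂L ≠ ⊤ := hF.lintegral_lt_top.ne
  have hwlim : ∀ᵐ y ∂L, Tendsto (fun n => w n y) atTop (𝓝 0) := by
    filter_upwards [hae] with y hy
    rw [ENNReal.tendsto_nhds_zero]
    intro η hη
    have h1 : Tendsto (fun t => ENNReal.ofReal (f y t)) (𝓝[s] t₀) (𝓝 0) := by
      simpa using ENNReal.tendsto_ofReal hy.2.2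
    rw [ENNReal.tendsto_nhds_zero] at h1
    obtain ⟨δ, hδ, hδs⟩ := Metric.mem_nhdsWithin_iff.1 (h1 η hη)
    have h2 : ∀ᶠ n in atTop, r n < δ :=
      (tendsto_one_div_add_atTop_nhds_zero_nat (𝕜 := ℝ)).eventually_lt_const hδ
    filter_upwards [h2] with n hn
    exact iSup₂_le fun t ht => hδs ⟨Metric.ball_subset_ball hn.le ht.2, hDs ht.1⟩
  -- The local suprema shrink to zero pointwise and are dominated by `F`, so one of them has
  -- integral at most `ε`.
  have hlim := tendsto_lintegral_of_dominated_convergence' _ hwm hwF hFfin hwlim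
  simp only [lintegral_zero] at hlim
  rw [ENNReal.tendsto_nhds_zero] at hlim
  obtain ⟨n, hn⟩ := (hlim (ENNReal.ofReal ε) (by simpa using hε)).exists
  have hfin : ∫⁻ y, w n y ∂L ≠ ⊤ := (hn.trans_lt ENNReal.ofReal_lt_top).ne
  refine ⟨r n, hr n, fun y => (w n y).toReal, fun _ => ENNReal.toReal_nonneg,
    integrable_toReal_of_lintegral_ne_top (hwm n) hfin, ?_, ?_⟩
  · rw [integral_toReal (hwm n) (ae_lt_top' (hwm n) hfin)]
    exact ENNReal.toReal_le_of_le_ofReal hε.le hn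
  · filter_upwards [hae, ae_lt_top' (hwm n) hfin] with y hy hyt t hts ht
    have hcl : t ∈ closure (D ∩ Metric.ball t₀ (r n)) := by
      rw [Set.inter_comm]
      exact Metric.isOpen_ball.inter_closure ⟨ht, hD hts⟩
    refine ContinuousWithinAt.closure_le hcl
      ((hy.1 t hts).mono (Set.inter_subset_left.trans hDs)) continuousWithinAt_const
      fun u hu => ?_
    rw [← ENNReal.ofReal_le_iff_le_toReal hyt.ne]
    exact le_iSup₂ (f := fun t (_ : t ∈ D ∩ Metric.ball t₀ (r n)) => ENNReal.ofReal (f y t)) u hu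

end Modulus

/-! ### Differentiability in mean -/

section MeanDifferentiable

variable {O E F : Type*} [MeasurableSpace O] {L : Measure O} [NormedAddCommGroup E]
  [NormedSpace ℝ E] [NormedAddCommGroup F] [NormedSpace ℝ F]

/-- `f y` is differentiable at `θ₀` for almost every `y`, with integrable derivative and with a
remainder that is dominated, near `θ₀`, by functions of arbitrarily small integral. -/
structure MeanDifferentiableAt (L : Measure O) (f : O → E → ℝ) (θ₀ : E) : Prop where
  differentiableAt : ∀ᵐ y ∂L, DifferentiableAt ℝ (f y) θ₀
  integrable : ∀ v, Integrable (fun y => fderiv ℝ (f y) θ₀ v) L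
  remainder : ∀ ε > 0, ∃ δ > 0, ∃ w : O → ℝ, (∀ y, 0 ≤ w y) ∧ Integrable w L ∧
    ∫ y, w y ∂L ≤ ε ∧ ∀ᵐ y ∂L, ∀ θ, dist θ θ₀ < δ →
      |f y θ - f y θ₀ - fderiv ℝ (f y) θ₀ (θ - θ₀)| ≤ w y * ‖θ - θ₀‖

namespace MeanDifferentiableAt

theorem add {f g : O → E → ℝ} {θ₀ : E} (hf : MeanDifferentiableAt L f θ₀)
    (hg : MeanDifferentiableAt L g θ₀) :
    MeanDifferentiableAt L (fun y θ => f y θ + g y θ) θ₀ := by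
  have hd : ∀ᵐ y ∂L, fderiv ℝ (fun θ => f y θ + g y θ) θ₀ =
      fderiv ℝ (f y) θ₀ + fderiv ℝ (g y) θ₀ := by
    filter_upwards [hf.differentiableAt, hg.differentiableAt] with y h1 h2
    exact fderiv_fun_add h1 h2
  refine ⟨?_, fun v => ?_, fun ε hε => ?_⟩
  · filter_upwards [hf.differentiableAt, hg.differentiableAt] with y h1 h2
    exact h1.fun_add h2
  · refine ((hf.integrable v).add (hg.integrable v)).congr ?_
    filter_upwards [hd] with y hy
    simp [hy]
  · obtain ⟨δ₁, hδ₁, w₁, hp₁, hw₁, hi₁, h₁⟩ := hf.remainder (ε / 2) (half_pos hε)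
    obtain ⟨δ₂, hδ₂, w₂, hp₂, hw₂, hi₂, h₂⟩ := hg.remainder (ε / 2) (half_pos hε)
    refine ⟨min δ₁ δ₂, lt_min hδ₁ hδ₂, fun y => w₁ y + w₂ y,
      fun y => add_nonneg (hp₁ y) (hp₂ y), hw₁.add hw₂, ?_, ?_⟩
    · rw [integral_add hw₁ hw₂]
      linarith
    · filter_upwards [hd, h₁, h₂] with y hy h1 h2 θ hθ
      rw [hy, _root_.add_apply, add_mul]
      refine le_trans (le_of_eq ?_) ((abs_add_le _ _).trans (add_le_add
        (h1 θ (hθ.trans_le (min_le_left _ _))) (h2 θ (hθ.trans_le (min_le_right _ _)))))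
      congr 1
      ring

/-- The remainder is `v y` times a deterministic one, so a small multiple of `|v|` dominates it.
Sums of such terms cover all functions polynomial in the parameter with integrable random
coefficients. -/
theorem mul {v : O → ℝ} (hv : Integrable v L) {f : E → ℝ} {θ₀ : E}
    (hf : DifferentiableAt ℝ f θ₀) : MeanDifferentiableAt L (fun y θ => v y * f θ) θ₀ := by
  have hd (y : O) : fderiv ℝ (fun θ => v y * f θ) θ₀ = v y • fderiv ℝ f θ₀ :=
    fderiv_const_mul hf _
  refine ⟨ae_of_all _ fun y => hf.const_mul _, fun u => ?_, fun ε hε => ?_⟩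
  · simp only [hd, _root_.smul_apply, smul_eq_mul]
    exact hv.mul_const _
  · have hI : 0 ≤ ∫ y, |v y| ∂L := integral_nonneg fun _ => abs_nonneg _
    -- The added one avoids division by zero when `v` vanishes almost everywhere.
    set c : ℝ := ε / ((∫ y, |v y| ∂L) + 1) with hc
    have hc0 : 0 < c := by positivity
    obtain ⟨δ, hδ, hball⟩ := Metric.eventually_nhds_iff.1
      (hf.hasFDerivAt.isLittleO.def hc0)
    refine ⟨δ, hδ, fun y => c * |v y|, fun y => by positivity, hv.abs.const_mul c, ?_,
      ae_of_all _ fun y θ hθ => ?_⟩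
    · rw [integral_const_mul, hc, div_mul_eq_mul_div, div_le_iff₀ (by positivity)]
      nlinarith
    · have h := hball hθ
      rw [Real.norm_eq_abs] at h
      rw [hd, _root_.smul_apply, smul_eq_mul, ← mul_sub, ← mul_sub, abs_mul]
      calc |v y| * |f θ - f θ₀ - fderiv ℝ f θ₀ (θ - θ₀)| ≤ |v y| * (c * ‖θ - θ₀‖) := by gcongr
        _ = c * |v y| * ‖θ - θ₀‖ := by ring

theorem const [IsFiniteMeasure L] {f : E → ℝ} {θ₀ : E} (hf : DifferentiableAt ℝ f θ₀) :
    MeanDifferentiableAt L (fun _ => f) θ₀ := by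
  simpa using mul (L := L) (integrable_const (1 : ℝ)) hf

/-- Each block of the stacked function depends on some coordinates only. It is treated in those and
pulled back along the coordinate projection, at the price of a factor `‖A‖ + 1`. -/
theorem comp_clm {f : O → F → ℝ} (A : E →L[ℝ] F) {θ₀ : E}
    (hf : MeanDifferentiableAt L f (A θ₀)) :
    MeanDifferentiableAt L (fun y θ => f y (A θ)) θ₀ := by
  have hd : ∀ᵐ y ∂L, fderiv ℝ (fun θ => f y (A θ)) θ₀ = (fderiv ℝ (f y) (A θ₀)).comp A := by
    filter_upwards [hf.differentiableAt] with y hy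
    exact (hy.hasFDerivAt.comp θ₀ A.hasFDerivAt).fderiv
  refine ⟨?_, fun v => ?_, fun ε hε => ?_⟩
  · filter_upwards [hf.differentiableAt] with y hy
    exact (hy.hasFDerivAt.comp θ₀ A.hasFDerivAt).differentiableAt
  · refine (hf.integrable (A v)).congr ?_
    filter_upwards [hd] with y hy
    simp [hy]
  · have hC : 0 < ‖A‖ + 1 := by positivity
    obtain ⟨δ, hδ, w, hp, hw, hi, h⟩ := hf.remainder (ε / (‖A‖ + 1)) (by positivity)
    refine ⟨δ / (‖A‖ + 1), by positivity, fun y => w y * (‖A‖ + 1),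
      fun y => mul_nonneg (hp y) hC.le, hw.mul_const _, ?_, ?_⟩
    · rw [integral_mul_const]
      exact (le_div_iff₀ hC).1 hi
    · filter_upwards [hd, h] with y hy h1 θ hθ
      have hA : ‖A θ - A θ₀‖ ≤ (‖A‖ + 1) * ‖θ - θ₀‖ := by
        rw [← map_sub]
        refine (A.le_opNorm _).trans ?_
        gcongr
        linarith
      rcases eq_or_ne θ θ₀ with rfl | hne
      · simp
      have hdist : dist (A θ) (A θ₀) < δ := by
        rw [dist_eq_norm]
        refine hA.trans_lt ?_
        rw [dist_eq_norm, lt_div_iff₀ hC] at hθ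
        linarith
      have h2 := h1 (A θ) hdist
      rw [hy, ContinuousLinearMap.comp_apply, map_sub]
      calc _ ≤ w y * ‖A θ - A θ₀‖ := h2
        _ ≤ w y * ((‖A‖ + 1) * ‖θ - θ₀‖) := mul_le_mul_of_nonneg_left hA (hp y)
        _ = w y * (‖A‖ + 1) * ‖θ - θ₀‖ := by ring

end MeanDifferentiableAt

end MeanDifferentiable

/-! ### Linearization of estimating equations -/

section Linearization

variable {Ω O : Type*} [MeasurableSpace Ω] [MeasurableSpace O] {P : Measure Ω}
  [IsProbabilityMeasure P] {o : ℕ → Ω → O} {L : Measure O} {ι : Type*} [Fintype ι]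
  [DecidableEq ι]

/-- The error has two parts: the averaged derivative differs from its expectation by `o(1)`, and the
averaged remainder is at most the mean of `w` times `‖θ̂ - θ₀‖`. Because `w` does not depend on the
parameter, the pointwise law of large numbers suffices although `θ̂` is random. -/
theorem isLittleO_sampleMean_sub {ψ : O → (ι → ℝ) → ℝ} {θ₀ : ι → ℝ} (hs : IsIIDSample P o L)
    (hψ : MeanDifferentiableAt L ψ θ₀) {θhat : ℕ × Ω → ι → ℝ}
    (hθ : Tendsto θhat (inProbability P) (𝓝 θ₀)) :
    (fun x => sampleMean o (fun y => ψ y (θhat x)) x - sampleMean o (fun y => ψ y θ₀) x -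
      ∑ b, (∫ y, fderiv ℝ (ψ y) θ₀ (Pi.single b 1) ∂L) * (θhat x b - θ₀ b))
      =o[inProbability P] fun x => θhat x - θ₀ := by
  have hlin : (fun x => ∑ b, (sampleMean o (fun y => fderiv ℝ (ψ y) θ₀ (Pi.single b 1)) x -
      ∫ y, fderiv ℝ (ψ y) θ₀ (Pi.single b 1) ∂L) * (θhat x b - θ₀ b))
      =o[inProbability P] fun x => θhat x - θ₀ := by
    refine Asymptotics.IsLittleO.fun_sum fun b _ => ?_
    have h1 : (fun x => sampleMean o (fun y => fderiv ℝ (ψ y) θ₀ (Pi.single b 1)) x -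
        ∫ y, fderiv ℝ (ψ y) θ₀ (Pi.single b 1) ∂L) =o[inProbability P] fun _ => (1 : ℝ) := by
      rw [Asymptotics.isLittleO_one_iff]
      simpa using (hs.tendsto_sampleMean (hψ.integrable (Pi.single b 1))).sub_const
        (∫ y, fderiv ℝ (ψ y) θ₀ (Pi.single b 1) ∂L)
    have h2 : (fun x => θhat x b - θ₀ b) =O[inProbability P] fun x => ‖θhat x - θ₀‖ :=
      Asymptotics.IsBigO.of_bound 1 (Eventually.of_forall fun x => by
        simpa using norm_le_pi_norm (θhat x - θ₀) b)
    simpa using (h1.mul_isBigO h2).norm_right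
  have hrem : (fun x => sampleMean o (fun y => ψ y (θhat x) - ψ y θ₀ -
      fderiv ℝ (ψ y) θ₀ (θhat x - θ₀)) x) =o[inProbability P] fun x => θhat x - θ₀ := by
    rw [Asymptotics.isLittleO_iff]
    intro ε hε
    -- With `∫ w ≤ ε / 2`, the sample mean of `w` is below `ε` with probability tending to one.
    obtain ⟨δ, hδ, w, -, hwi, hwε, hae⟩ := hψ.remainder (ε / 2) (half_pos hε)
    have hw := (hs.tendsto_sampleMean hwi).eventually_lt_const
      (show ∫ y, w y ∂L < ε by linarith)
    filter_upwards [hw, eventually_inProbability_of_ae (hs.ae hae),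
      Metric.tendsto_nhds.1 hθ δ hδ] with x hx1 hx2 hx3
    rw [Real.norm_eq_abs]
    refine (abs_sampleMean_le (g := fun y => w y * ‖θhat x - θ₀‖)
      fun i => hx2 i _ hx3).trans ?_
    rw [sampleMean_mul_const]
    gcongr
  refine (hlin.add hrem).congr_left fun x => ?_
  have hexp (y : O) : fderiv ℝ (ψ y) θ₀ (θhat x - θ₀) =
      ∑ b, fderiv ℝ (ψ y) θ₀ (Pi.single b 1) * (θhat x b - θ₀ b) := by
    conv_lhs => rw [pi_eq_sum_univ' (θhat x - θ₀)]
    simp [mul_comm]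
  simp only [sampleMean_sub, hexp, sampleMean_sum, sampleMean_mul_const, sub_mul,
    Finset.sum_sub_distrib]
  ring

/-- A consistent root of an estimating equation is asymptotically linear. -/
theorem tendsto_sqrt_smul_estimator_add {ψ : O → (ι → ℝ) → ι → ℝ} {θ₀ : ι → ℝ}
    (hs : IsIIDSample P o L) (hψ : ∀ a, MeanDifferentiableAt L (fun y θ => ψ y θ a) θ₀)
    (hL2 : ∀ a, MemLp (fun y => ψ y θ₀ a) 2 L) (hmean : ∀ a, ∫ y, ψ y θ₀ a ∂L = 0)
    {A : Matrix ι ι ℝ}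
    (hA : ∀ a b, A a b = ∫ y, fderiv ℝ (fun θ => ψ y θ a) θ₀ (Pi.single b 1) ∂L)
    (hdet : A.det ≠ 0) {θhat : ℕ × Ω → ι → ℝ}
    (hθ : Tendsto θhat (inProbability P) (𝓝 θ₀))
    (hroot : ∀ᶠ x in inProbability P, sampleMean o (fun y => ψ y (θhat x)) x = 0) :
    Tendsto (fun x => √(x.1 : ℝ) • (θhat x - θ₀) +
      A⁻¹ *ᵥ (√(x.1 : ℝ) • sampleMean o (fun y => ψ y θ₀) x)) (inProbability P) (𝓝 0) := by
  set S : ℕ × Ω → ι → ℝ := sampleMean o fun y => ψ y θ₀ with hS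
  have h1 : (fun x => S x + A *ᵥ (θhat x - θ₀)) =o[inProbability P] fun x => θhat x - θ₀ := by
    rw [Asymptotics.isLittleO_pi]
    intro a
    refine (isLittleO_sampleMean_sub hs (hψ a) hθ).neg_left.congr' ?_ EventuallyEq.rfl
    filter_upwards [hroot] with x hx
    have hxa : sampleMean o (fun y => ψ y (θhat x) a) x = 0 := by
      rw [← sampleMean_apply, hx]; rfl
    simp only [hxa, Pi.add_apply, Matrix.mulVec, dotProduct, hA, Pi.sub_apply, hS,
      sampleMean_apply]
    ring
  have hdet' : IsUnit A.det := isUnit_iff_ne_zero.2 hdet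
  have hmv (u : ℕ × Ω → ι → ℝ) : (fun x => A⁻¹ *ᵥ u x) =O[inProbability P] u :=
    (A⁻¹.mulVecLin.toContinuousLinearMap).isBigO_comp u _
  have h2 : (fun x => (-(A⁻¹ *ᵥ S x)) - (θhat x - θ₀)) =o[inProbability P]
      fun x => θhat x - θ₀ := by
    refine ((hmv _).trans_isLittleO h1).neg_left.congr_left fun x => ?_
    rw [Matrix.mulVec_add, Matrix.mulVec_mulVec, Matrix.nonsing_inv_mul _ hdet',
      Matrix.one_mulVec]
    abel
  -- By symmetry of asymptotic equivalence, an error small relative to `θ̂ - θ₀` is also small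
  -- relative to `S`. No convergence rate for `θ̂` is required beforehand.
  have h3 : Asymptotics.IsEquivalent (inProbability P) (fun x => -(A⁻¹ *ᵥ S x))
      fun x => θhat x - θ₀ := h2
  have h4 : (fun x => (θhat x - θ₀) + A⁻¹ *ᵥ S x) =o[inProbability P] S := by
    refine (h3.symm.isLittleO.congr_left fun x => ?_).trans_isBigO (hmv S).neg_left
    simp
  have h5 := (Asymptotics.isBigO_refl (fun x : ℕ × Ω => √(x.1 : ℝ))
    (inProbability P)).smul_isLittleO h4
  refine (tendsto_zero_of_isLittleO h5 (BoundedInProbability.pi fun a => ?_)).congr fun x => ?_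
  · simpa [hS, sampleMean_apply] using hs.boundedInProbability (hL2 a) (hmean a)
  · simp [Matrix.mulVec_smul]

end Linearization

/-! ### The multivariate central limit theorem -/

section CentralLimit

variable {Ω O : Type*} [MeasurableSpace Ω] [MeasurableSpace O] {P : Measure Ω}
  [IsProbabilityMeasure P] {o : ℕ → Ω → O} {L : Measure O} {ι : Type*} [Fintype ι]

theorem IsIIDSample.isProbabilityMeasure (hs : IsIIDSample P o L) : IsProbabilityMeasure L := by
  rw [← hs.map_eq 0]
  exact Measure.isProbabilityMeasure_map (hs.measurable 0).aemeasurable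

/-- This follows by expanding the square. It yields both positive semidefiniteness and the variances
of the one-dimensional projections in the central limit theorem. -/
theorem dotProduct_secondMoment_mulVec {f : O → ι → ℝ} (hf : ∀ i, MemLp (fun y => f y i) 2 L)
    {C : Matrix ι ι ℝ} (hC : ∀ i j, C i j = ∫ y, f y i * f y j ∂L) (t : ι → ℝ) :
    t ⬝ᵥ C *ᵥ t = ∫ y, (t ⬝ᵥ f y) ^ 2 ∂L := by
  have hint (i j : ι) : Integrable (fun y => t i * (f y i * f y j * t j)) L :=
    (((hf i).integrable_mul (hf j)).mul_const _).const_mul _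
  have hsq (y : O) : (t ⬝ᵥ f y) ^ 2 = ∑ i, ∑ j, t i * (f y i * f y j * t j) := by
    simp only [dotProduct, pow_two, Finset.sum_mul_sum]
    exact Finset.sum_congr rfl fun i _ => Finset.sum_congr rfl fun j _ => by ring
  simp only [hsq]
  rw [integral_finsetSum _ fun i _ => integrable_finsetSum _ fun j _ => hint i j]
  simp only [dotProduct, mulVec, Finset.mul_sum, hC]
  refine Finset.sum_congr rfl fun i _ => ?_
  rw [integral_finsetSum _ fun j _ => hint i j]
  refine Finset.sum_congr rfl fun j _ => ?_
  rw [integral_const_mul, integral_mul_const]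

theorem posSemidef_secondMoment {f : O → ι → ℝ} (hf : ∀ i, MemLp (fun y => f y i) 2 L)
    {C : Matrix ι ι ℝ} (hC : ∀ i j, C i j = ∫ y, f y i * f y j ∂L) : C.PosSemidef := by
  refine Matrix.PosSemidef.of_dotProduct_mulVec_nonneg ?_ fun t => ?_
  · ext i j
    simp [hC, mul_comm]
  · rw [star_trivial, dotProduct_secondMoment_mulVec hf hC]
    exact integral_nonneg fun y => sq_nonneg _

/-- The central limit theorem for centered square-integrable random vectors. -/
theorem IsIIDSample.tendstoInDistribution [DecidableEq ι] (hs : IsIIDSample P o L)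
    {f : O → ι → ℝ} (hf : ∀ i, MemLp (fun y => f y i) 2 L) (h0 : ∀ i, ∫ y, f y i ∂L = 0)
    {C : Matrix ι ι ℝ} (hC : ∀ i j, C i j = ∫ y, f y i * f y j ∂L) :
    TendstoInDistribution
      (fun (n : ℕ) ω => WithLp.toLp 2 (√(n : ℝ) • sampleMean o f (n, ω))) atTop
      (id : EuclideanSpace ℝ ι → EuclideanSpace ℝ ι) (fun _ => P)
      (multivariateGaussian 0 C) := by
  have : IsProbabilityMeasure L := hs.isProbabilityMeasure
  have hpsd := posSemidef_secondMoment hf hC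
  have hfm : AEMeasurable f L :=
    aemeasurable_pi_lambda _ fun i => (hf i).aestronglyMeasurable.aemeasurable
  have hfi (i : ℕ) : AEMeasurable (fun ω => f (o i ω)) P :=
    (hs.identDistrib hfm i).aemeasurable_fst
  have hmeas (n : ℕ) : AEMeasurable
      (fun ω => WithLp.toLp 2 (√(n : ℝ) • sampleMean o f (n, ω)) : Ω → EuclideanSpace ℝ ι) P := by
    refine (WithLp.measurable_toLp 2 (ι → ℝ)).comp_aemeasurable ?_
    simp only [sampleMean]
    exact AEMeasurable.const_smul (AEMeasurable.const_smul
      (Finset.aemeasurable_fun_sum _ fun i _ => hfi i) (n : ℝ)⁻¹) (√(n : ℝ))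
  refine ⟨hmeas, aemeasurable_id, ?_⟩
  -- Lévy continuity combined with the Cramér–Wold device: the characteristic function at `t` is
  -- that of the scalar sample `g = t ⬝ᵥ f` at `1`, to which the scalar central limit theorem
  -- applies.
  refine ProbabilityMeasure.tendsto_iff_tendsto_charFun.2 fun t => ?_
  simp only [ProbabilityMeasure.coe_mk, Measure.map_id]
  let g : O → ℝ := fun y => t.ofLp ⬝ᵥ f y
  have hg : MemLp g 2 L := memLp_finsetSum _ fun i _ => (hf i).const_mul (t i)
  have hg0 : ∫ y, g y ∂L = 0 := by
    simp only [g, dotProduct]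
    rw [integral_finsetSum _ fun i _ => ((hf i).integrable (by simp)).const_mul _]
    simp [integral_const_mul, h0]
  have hgm := hg.aestronglyMeasurable.aemeasurable
  have hmean : ∫ ω, g (o 0 ω) ∂P = 0 := by
    rw [hs.integral_comp hg.aestronglyMeasurable, hg0]
  have hvar : Var[fun ω => g (o 0 ω); P] = t.ofLp ⬝ᵥ C *ᵥ t.ofLp := by
    rw [variance_eq_integral (hs.identDistrib hgm 0).aemeasurable_fst, hmean,
      dotProduct_secondMoment_mulVec hf hC]
    simp only [sub_zero]
    exact hs.integral_comp (f := fun y => g y ^ 2) (hg.aestronglyMeasurable.pow 2)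
  have hclt := tendstoInDistribution_inv_sqrt_mul_sum_sub (P := P)
    (P' := gaussianReal 0 Var[fun ω => g (o 0 ω); P].toNNReal)
    (Y := id) (X := fun i ω => g (o i ω)) ⟨aemeasurable_id, Measure.map_id⟩ (hs.memLp_comp hg 0)
    (hs.iIndepFun_comp hgm) (hs.identDistrib hgm)
  have h1 := ProbabilityMeasure.tendsto_iff_tendsto_charFun.1 hclt.tendsto 1
  simp only [ProbabilityMeasure.coe_mk, Measure.map_id, hmean, mul_zero, sub_zero,
    charFun_gaussianReal, hvar] at h1
  have hv0 : 0 ≤ t.ofLp ⬝ᵥ C *ᵥ t.ofLp := by rw [← hvar]; exact variance_nonneg _ _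
  rw [charFun_multivariateGaussian hpsd]
  convert h1 using 2 with n
  · rw [charFun_apply, charFun_apply_real, integral_map (hmeas n) (by fun_prop),
      integral_map _ (by fun_prop)]
    · refine integral_congr_ae (ae_of_all _ fun ω => ?_)
      have hin : (inner ℝ (WithLp.toLp 2 (√(n : ℝ) • sampleMean o f (n, ω))) t : ℝ) =
          (√(n : ℝ))⁻¹ * ∑ k ∈ Finset.range n, g (o k ω) := by
        have hn : √(n : ℝ) * (n : ℝ)⁻¹ = (√(n : ℝ))⁻¹ := by
          rcases Nat.eq_zero_or_pos n with rfl | hn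
          · simp
          · rw [← div_eq_mul_inv, Real.sqrt_div_self]
        simp only [PiLp.inner_apply, g, dotProduct, sampleMean, smul_smul, hn, Pi.smul_apply,
          Finset.sum_apply, smul_eq_mul, RCLike.inner_apply, conj_trivial]
        rw [Finset.sum_comm, Finset.mul_sum]
        refine Finset.sum_congr rfl fun i _ => ?_
        rw [← Finset.mul_sum]
        ring
      simp only [hin, Complex.ofReal_one, one_mul]
    · exact (Finset.aemeasurable_fun_sum _ fun i _ =>
        (hs.identDistrib hgm i).aemeasurable_fst).const_mul _
  · simp [hv0]
end CentralLimit

/-! ### Moments of the proxies -/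

section Moments

variable {Ω : Type*} {p q k : ℕ} {S : Subjects Ω p q k} {M : ErrorModel p k}

/-- The factor by which an error enters the proxy. -/
def ErrorModel.errCoef (M : ErrorModel p k) (j : Fin k) (r : Fin p) (x : Fin p → ℝ) : ℝ :=
  match M.kind j with
  | .additive => 1
  | .multiplicative => M.eta1 j r * x r

/-- Expanding the product in the multiplicative case gives one affine form for both error
structures; afterwards they differ only through `errCoef`. -/
theorem ErrorModel.proxy_apply (M : ErrorModel p k) (j : Fin k) (x e : Fin p → ℝ) (r : Fin p) :
    M.proxy j x e r = M.eta0 j r + M.eta1 j r * x r + M.errCoef j r x * e r := by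
  unfold ErrorModel.proxy ErrorModel.errCoef
  cases M.kind j
  · simp
  · simp only
    ring

theorem ErrorModel.measurable_errCoef (M : ErrorModel p k) (j : Fin k) (r : Fin p) :
    Measurable (M.errCoef j r) := by
  unfold ErrorModel.errCoef
  cases M.kind j
  · exact measurable_const
  · exact (measurable_pi_apply r).const_mul _

theorem ErrorModel.measurable_proxy (M : ErrorModel p k) (j : Fin k) :
    Measurable fun d : (Fin p → ℝ) × (Fin p → ℝ) => M.proxy j d.1 d.2 := by
  refine measurable_pi_lambda _ fun r => ?_
  simp only [M.proxy_apply]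
  have := M.measurable_errCoef j r
  fun_prop

/-- The centered part of a proxy that is due to the error. -/
def Subjects.noise (S : Subjects Ω p q k) (M : ErrorModel p k) (j : Fin k) (r : Fin p) (ω : Ω) :
    ℝ :=
  M.errCoef j r (S.X 0 ω) * S.err 0 j ω r

theorem Subjects.Xstar_apply (S : Subjects Ω p q k) (M : ErrorModel p k) (j : Fin k)
    (r : Fin p) (ω : Ω) : S.Xstar M 0 j ω r =
      M.eta0 j r + M.eta1 j r * S.X 0 ω r + S.noise M j r ω :=
  M.proxy_apply j _ _ r

variable [MeasurableSpace Ω] {P : Measure Ω}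

/-- The moment conditions on the covariates and the errors. -/
structure FourthMoments (P : Measure Ω) (S : Subjects Ω p q k) : Prop where
  X : ∀ r, MemLp (fun ω => S.X 0 ω r) 4 P
  Z : ∀ a, MemLp (fun ω => S.Z 0 ω a) 4 P
  err : ∀ j r, MemLp (fun ω => S.err 0 j ω r) 4 P

theorem memLp_two_mul {f g : Ω → ℝ} (hf : MemLp f 4 P) (hg : MemLp g 4 P) :
    MemLp (fun ω => f ω * g ω) 2 P := by
  have : ENNReal.HolderTriple 4 4 2 := ⟨by
    rw [show (4 : ENNReal) = 2 * 2 by norm_num, ENNReal.mul_inv (by simp) (by simp), ← mul_add,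
      ENNReal.inv_two_add_inv_two, mul_one]⟩
  exact hg.mul' hf

theorem IsMeasurementErrorModel.integral_data_mul_err
    (hm : IsMeasurementErrorModel P S M) {φ : ℝ × (Fin p → ℝ) × (Fin q → ℝ) → ℝ}
    {χ : (Fin k → Fin p → ℝ) → ℝ} (hφ : Measurable φ) (hχ : Measurable χ) :
    ∫ ω, φ (S.Y 0 ω, S.X 0 ω, S.Z 0 ω) * χ (fun j => S.err 0 j ω) ∂P =
      (∫ ω, φ (S.Y 0 ω, S.X 0 ω, S.Z 0 ω) ∂P) * ∫ ω, χ (fun j => S.err 0 j ω) ∂P := by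
  have hY := hm.measurable_Y 0
  have hX := hm.measurable_X 0
  have hZ := hm.measurable_Z 0
  have he := hm.measurable_err 0
  refine IndepFun.integral_fun_mul_eq_mul_integral (hm.indep_err_data.comp hφ hχ) ?_ ?_
  · exact (hφ.comp (hY.prodMk (hX.prodMk hZ))).aestronglyMeasurable
  · exact (hχ.comp (measurable_pi_lambda _ he)).aestronglyMeasurable

/-- Independence factors the fourth moment of the product, where Hölder would leave only second
moments. Multiplicative proxies, which contain `X ∘ ε`, thus retain fourth moments. -/
theorem memLp_four_mul_of_indepFun {f g : Ω → ℝ} (hfg : IndepFun f g P) (hf : MemLp f 4 P)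
    (hg : MemLp g 4 P) : MemLp (fun ω => f ω * g ω) 4 P := by
  have hm := hf.aestronglyMeasurable.mul hg.aestronglyMeasurable
  refine (integrable_norm_rpow_iff hm (by norm_num) (by norm_num)).1 ?_
  have h1 := (integrable_norm_rpow_iff hf.aestronglyMeasurable (by norm_num) (by norm_num)).2 hf
  have h2 := (integrable_norm_rpow_iff hg.aestronglyMeasurable (by norm_num) (by norm_num)).2 hg
  have hind : IndepFun (fun ω => ‖f ω‖ ^ (4 : ENNReal).toReal)
      (fun ω => ‖g ω‖ ^ (4 : ENNReal).toReal) P :=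
    hfg.comp (φ := fun x : ℝ => ‖x‖ ^ (4 : ENNReal).toReal)
      (ψ := fun x : ℝ => ‖x‖ ^ (4 : ENNReal).toReal) (by fun_prop) (by fun_prop)
  refine (hind.integrable_mul h1 h2).congr (ae_of_all _ fun ω => ?_)
  simp [mul_pow]

/-- The factor `errCoef` is a function of `X` and can be absorbed into `φ`. The expectation then
factors, and the error has mean zero. -/
theorem IsMeasurementErrorModel.integral_mul_noise
    (hm : IsMeasurementErrorModel P S M) {φ : ℝ × (Fin p → ℝ) × (Fin q → ℝ) → ℝ} (hφ : Measurable φ)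
    (j : Fin k) (r : Fin p) :
    ∫ ω, φ (S.Y 0 ω, S.X 0 ω, S.Z 0 ω) * S.noise M j r ω ∂P = 0 := by
  have h := hm.integral_data_mul_err (φ := fun d => φ d * M.errCoef j r d.2.1)
    (χ := fun e => e j r)
    (hφ.mul ((M.measurable_errCoef j r).comp (measurable_fst.comp measurable_snd)))
    (by fun_prop)
  rw [hm.mean_err, mul_zero] at h
  simpa only [Subjects.noise, mul_assoc] using h

theorem IsMeasurementErrorModel.integral_noise_mul_noise
    (hm : IsMeasurementErrorModel P S M) (j l : Fin k) (r s : Fin p) :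
    ∫ ω, S.noise M j r ω * S.noise M l s ω ∂P =
      (∫ ω, M.errCoef j r (S.X 0 ω) * M.errCoef l s (S.X 0 ω) ∂P) *
        ∫ ω, S.err 0 j ω r * S.err 0 l ω s ∂P := by
  have h := hm.integral_data_mul_err
    (φ := fun d => M.errCoef j r d.2.1 * M.errCoef l s d.2.1)
    (χ := fun e => e j r * e l s)
    (((M.measurable_errCoef j r).comp (measurable_fst.comp measurable_snd)).mul
      ((M.measurable_errCoef l s).comp (measurable_fst.comp measurable_snd)))
    (by fun_prop)
  rw [← h]
  congr 1 with ω
  simp only [Subjects.noise]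
  ring

theorem IsMeasurementErrorModel.integral_noise
    (hm : IsMeasurementErrorModel P S M) (j : Fin k) (r : Fin p) : ∫ ω, S.noise M j r ω ∂P = 0 := by
  simpa using hm.integral_mul_noise (φ := fun _ => 1) measurable_const j r

variable [IsProbabilityMeasure P]

theorem memLp_two_of_four {f : Ω → ℝ} (hf : MemLp f 4 P) : MemLp f 2 P :=
  hf.mono_exponent (by norm_num)

namespace IsMeasurementErrorModel

variable (hm : IsMeasurementErrorModel P S M)

include hm

theorem memLp_noise (h4 : FourthMoments P S) (j : Fin k) (r : Fin p) :
    MemLp (S.noise M j r) 4 P := by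
  refine memLp_four_mul_of_indepFun ?_ ?_ (h4.err j r)
  · exact hm.indep_err_data.comp
      (φ := fun d : ℝ × (Fin p → ℝ) × (Fin q → ℝ) => M.errCoef j r d.2.1)
      (ψ := fun e : Fin k → Fin p → ℝ => e j r)
      ((M.measurable_errCoef j r).comp (measurable_fst.comp measurable_snd)) (by fun_prop)
  · unfold ErrorModel.errCoef
    cases M.kind j
    · exact memLp_const _
    · exact (h4.X r).const_mul _

theorem memLp_Xstar (h4 : FourthMoments P S) (j : Fin k) (r : Fin p) :
    MemLp (fun ω => S.Xstar M 0 j ω r) 4 P := by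
  simp only [S.Xstar_apply]
  have h1 : MemLp (fun _ : Ω => M.eta0 j r) 4 P := memLp_const _
  have h2 : MemLp (fun ω => M.eta1 j r * S.X 0 ω r) 4 P := (h4.X r).const_mul _
  exact MemLp.add (f := fun ω => M.eta0 j r + M.eta1 j r * S.X 0 ω r) (MemLp.add h1 h2)
    (hm.memLp_noise h4 j r)

/-- Two multiplicative noises share `X` and need not be independent. They are still uncorrelated,
since the errors separate from `X` and have a product of mean zero. -/
theorem covariance_noise_of_ne (h4 : FourthMoments P S) {j l : Fin k} (hjl : j ≠ l)
    (r s : Fin p) : cov[S.noise M j r, S.noise M l s; P] = 0 := by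
  have he : ∫ ω, S.err 0 j ω r * S.err 0 l ω s ∂P = 0 := by
    have hi : IndepFun (fun ω => S.err 0 j ω r) (fun ω => S.err 0 l ω s) P :=
      (hm.indep_err.indepFun hjl).comp (measurable_pi_apply r) (measurable_pi_apply s)
    have := hi.integral_fun_mul_eq_mul_integral (h4.err j r).aestronglyMeasurable
      (h4.err l s).aestronglyMeasurable
    rw [this, hm.mean_err, zero_mul]
  rw [covariance_eq_sub (memLp_two_of_four (hm.memLp_noise h4 j r))
    (memLp_two_of_four (hm.memLp_noise h4 l s)), hm.integral_noise]
  simp only [Pi.mul_apply]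
  rw [hm.integral_noise_mul_noise, he]
  simp

/-- The second moments of `errCoef` and of the error factor. In the multiplicative case the former
is `ηᵣ ηₛ E(Xᵣ Xₛ)`, which explains the Hadamard product in `Mⱼ`. -/
theorem covariance_noise_self (h4 : FourthMoments P S) (j : Fin k) (r s : Fin p) :
    cov[S.noise M j r, S.noise M j s; P] = trueXi P S M (.errVar j r s) := by
  rw [covariance_eq_sub (memLp_two_of_four (hm.memLp_noise h4 j r))
    (memLp_two_of_four (hm.memLp_noise h4 j s)), hm.integral_noise]
  simp only [Pi.mul_apply]
  have hc : cov[fun ω => S.err 0 j ω r, fun ω => S.err 0 j ω s; P] =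
      ∫ ω, S.err 0 j ω r * S.err 0 j ω s ∂P := by
    rw [covariance_eq_sub (memLp_two_of_four (h4.err j r)) (memLp_two_of_four (h4.err j s)),
      hm.mean_err]
    simp
  rw [hm.integral_noise_mul_noise]
  simp only [trueXi, ErrorModel.errCoef, hc]
  cases M.kind j
  · simp
  · have hX : ∫ ω, M.eta1 j r * S.X 0 ω r * (M.eta1 j s * S.X 0 ω s) ∂P =
        M.eta1 j r * M.eta1 j s * ∫ ω, S.X 0 ω r * S.X 0 ω s ∂P := by
      rw [← integral_const_mul]
      congr 1 with ω
      ring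
    simp only [hX]
    ring

theorem covariance_data_noise (h4 : FourthMoments P S)
    {φ : ℝ × (Fin p → ℝ) × (Fin q → ℝ) → ℝ} (hφ : Measurable φ)
    (hφ4 : MemLp (fun ω => φ (S.Y 0 ω, S.X 0 ω, S.Z 0 ω)) 4 P) (j : Fin k) (r : Fin p) :
    cov[fun ω => φ (S.Y 0 ω, S.X 0 ω, S.Z 0 ω), S.noise M j r; P] = 0 := by
  rw [covariance_eq_sub (memLp_two_of_four hφ4) (memLp_two_of_four (hm.memLp_noise h4 j r)),
    hm.integral_noise]
  simp only [Pi.mul_apply]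
  rw [hm.integral_mul_noise hφ]
  simp

theorem covariance_X_noise (h4 : FourthMoments P S) (s : Fin p) (j : Fin k) (r : Fin p) :
    cov[fun ω => S.X 0 ω s, S.noise M j r; P] = 0 :=
  hm.covariance_data_noise h4 (φ := fun d => d.2.1 s) (by fun_prop) (h4.X s) j r

theorem covariance_Z_noise (h4 : FourthMoments P S) (a : Fin q) (j : Fin k) (r : Fin p) :
    cov[fun ω => S.Z 0 ω a, S.noise M j r; P] = 0 :=
  hm.covariance_data_noise h4 (φ := fun d => d.2.2 a) (by fun_prop) (h4.Z a) j r

theorem covariance_Xstar_right (h4 : FourthMoments P S) {V : Ω → ℝ} (hV : MemLp V 4 P)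
    (j : Fin k) (s : Fin p) : cov[V, fun ω => S.Xstar M 0 j ω s; P] =
      M.eta1 j s * cov[V, fun ω => S.X 0 ω s; P] + cov[V, S.noise M j s; P] := by
  have hX := (memLp_two_of_four (h4.X s)).const_mul (M.eta1 j s)
  have hU := memLp_two_of_four (hm.memLp_noise h4 j s)
  have heq : (fun ω => S.Xstar M 0 j ω s) = fun ω => M.eta0 j s +
      ((fun ω => M.eta1 j s * S.X 0 ω s) + S.noise M j s) ω := by
    ext ω
    simp [S.Xstar_apply, add_assoc]
  rw [heq, covariance_const_add_right ((hX.add hU).integrable (by simp)),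
    covariance_add_right (memLp_two_of_four hV) hX hU, covariance_const_mul_right]

theorem trueXi_mu (h4 : FourthMoments P S) (j : Fin k) (r : Fin p) :
    trueXi P S M (.mu j r) = M.eta0 j r + M.eta1 j r * trueXi P S M (.muX r) := by
  have hX := ((h4.X r).integrable (by norm_num)).const_mul (M.eta1 j r)
  simp only [trueXi, S.Xstar_apply]
  have h1 : Integrable (fun ω => M.eta0 j r + M.eta1 j r * S.X 0 ω r) P :=
    Integrable.add (integrable_const _) hX
  rw [integral_add h1
    ((hm.memLp_noise h4 j r).integrable (by norm_num)), integral_add (integrable_const _) hX,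
    hm.integral_noise, integral_const_mul]
  simp

theorem trueXi_sigXXstar (h4 : FourthMoments P S) (j : Fin k) (r s : Fin p) :
    trueXi P S M (.sigXXstar j r s) = trueXi P S M (.sigXX r s) * M.eta1 j s := by
  simp only [trueXi]
  rw [hm.covariance_Xstar_right h4 (h4.X r), hm.covariance_X_noise h4, add_zero, mul_comm]

theorem trueXi_sigZXstar (h4 : FourthMoments P S) (j : Fin k) (a : Fin q) (r : Fin p) :
    trueXi P S M (.sigZXstar j a r) = trueXi P S M (.sigZX a r) * M.eta1 j r := by
  simp only [trueXi]
  rw [hm.covariance_Xstar_right h4 (h4.Z a), hm.covariance_Z_noise h4, add_zero, mul_comm]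

theorem trueXi_sig (h4 : FourthMoments P S) (j l : Fin k) (r s : Fin p) :
    trueXi P S M (.sig j l r s) = M.eta1 j r * trueXi P S M (.sigXX r s) * M.eta1 l s +
      cov[S.noise M j r, S.noise M l s; P] := by
  simp only [trueXi]
  rw [hm.covariance_Xstar_right h4 (hm.memLp_Xstar h4 j r), covariance_comm,
    hm.covariance_Xstar_right h4 (h4.X s), hm.covariance_X_noise h4,
    covariance_comm (fun ω => S.Xstar M 0 j ω r),
    hm.covariance_Xstar_right h4 (hm.memLp_noise h4 l s), covariance_comm (S.noise M l s),
    hm.covariance_X_noise h4, covariance_comm (S.noise M l s),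
    covariance_comm (fun ω => S.X 0 ω s)]
  ring

end IsMeasurementErrorModel

end Moments

/-! ### The true correction parameters solve the correction equations -/

section TrueParameters

variable {Ω : Type*} [MeasurableSpace Ω] {P : Measure Ω} {p q k : ℕ} {S : Subjects Ω p q k}
  {M : ErrorModel p k}

theorem isUnit_det_diagonal {v : Fin p → ℝ} (hv : ∀ r, v r ≠ 0) :
    IsUnit (Matrix.diagonal v).det := by
  rw [Matrix.det_diagonal, isUnit_iff_ne_zero]
  exact Finset.prod_ne_zero_iff.2 fun r _ => hv r

theorem trueXi_eta1 (j : Fin k) : (trueXi P S M).eta1 j = Matrix.diagonal (M.eta1 j) := rfl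

/-- A diagonal entry of a Gram matrix is the squared length of a column, and the columns are assumed
nonzero. -/
theorem sigZX_transpose_mul_pos {c : Scheme} (hid : Identifiable c P S M)
    (hc : c = .covariates) (r : Fin p) :
    0 < ((trueXi P S M).sigZXᵀ * (trueXi P S M).sigZX) r r := by
  obtain ⟨a, ha⟩ := (hid.of_covariates hc).2 r
  simp only [Matrix.mul_apply, Matrix.transpose_apply]
  exact Finset.sum_pos' (fun b _ => mul_self_nonneg ((trueXi P S M).sigZX b r))
    ⟨a, Finset.mem_univ a, mul_self_pos.2 ha⟩

variable [IsProbabilityMeasure P] (hm : IsMeasurementErrorModel P S M) (h4 : FourthMoments P S)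

include hm h4

theorem sigXXstar_eq (j : Fin k) : (trueXi P S M).sigXXstar j =
    (trueXi P S M).sigXX * Matrix.diagonal (M.eta1 j) := by
  ext r s
  rw [Matrix.mul_diagonal]
  exact hm.trueXi_sigXXstar h4 j r s

theorem sigZXstar_eq (j : Fin k) : (trueXi P S M).sigZXstar j =
    (trueXi P S M).sigZX * Matrix.diagonal (M.eta1 j) := by
  ext a r
  rw [Matrix.mul_diagonal]
  exact hm.trueXi_sigZXstar h4 j a r

/-- The noise covariance drops out for distinct proxies. This is what identifies the slopes and
`Σ_XX` from replicates. -/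
theorem sig_eq_of_ne {j l : Fin k} (hjl : j ≠ l) : (trueXi P S M).sig j l =
    Matrix.diagonal (M.eta1 j) * (trueXi P S M).sigXX * Matrix.diagonal (M.eta1 l) := by
  ext r s
  rw [Matrix.mul_diagonal, Matrix.diagonal_mul]
  have := hm.trueXi_sig h4 j l r s
  rwa [hm.covariance_noise_of_ne h4 hjl, add_zero] at this

theorem sig_self_eq (j : Fin k) : (trueXi P S M).sig j j =
    Matrix.diagonal (M.eta1 j) * (trueXi P S M).sigXX * Matrix.diagonal (M.eta1 j) +
      (trueXi P S M).errVar j := by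
  ext r s
  rw [Matrix.add_apply, Matrix.mul_diagonal, Matrix.diagonal_mul]
  have := hm.trueXi_sig h4 j j r s
  rwa [hm.covariance_noise_self h4] at this

theorem isUnit_det_sigXXstar {c : Scheme} (hid : Identifiable c P S M) (hc : c = .proxies)
    (j : Fin k) : IsUnit ((trueXi P S M).sigXXstar j).det := by
  rw [sigXXstar_eq hm h4, Matrix.det_mul]
  exact (isUnit_iff_ne_zero.2 (hid.of_proxies hc).2).mul
    (isUnit_det_diagonal (hid.eta1_ne_zero j))

theorem sigZXstar_transpose_mul (j : Fin k) (r : Fin p) :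
    (((trueXi P S M).sigZXstar j)ᵀ * (trueXi P S M).sigZXstar j) r r =
      ((trueXi P S M).sigZXᵀ * (trueXi P S M).sigZX) r r * M.eta1 j r ^ 2 := by
  rw [sigZXstar_eq hm h4, Matrix.mul_apply, Matrix.mul_apply, Finset.sum_mul]
  simp only [Matrix.transpose_apply, Matrix.mul_diagonal]
  exact Finset.sum_congr rfl fun b _ => by ring

/-- With proxies, each summand is `Hⱼ Σ_XX Hₗ (Σ_XX Hₗ)⁻¹ = Hⱼ`. With covariates, the ratio of Gram
entries is the square of the slope, and positivity of the slope selects the root. -/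
theorem eta1Formula_trueXi {c : Scheme} (hid : Identifiable c P S M) (j : Fin k) :
    eta1Formula c (trueXi P S M) j = (trueXi P S M).eta1 j := by
  have hk : ((k : ℝ) - 1) ≠ 0 := by
    have : (2 : ℝ) ≤ k := by exact_mod_cast hid.two_le
    linarith
  cases c with
  | proxies =>
    have h (l : Fin k) (hl : l ∈ Finset.univ.erase j) : (trueXi P S M).sig j l *
        ((trueXi P S M).sigXXstar l)⁻¹ = (trueXi P S M).eta1 j := by
      have hu := isUnit_det_sigXXstar hm h4 hid rfl l
      rw [sig_eq_of_ne hm h4 (Finset.ne_of_mem_erase hl).symm, Matrix.mul_assoc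
        (Matrix.diagonal _), ← sigXXstar_eq hm h4, Matrix.mul_assoc, Matrix.mul_nonsing_inv _ hu,
        Matrix.mul_one]
      rfl
    simp only [eta1Formula]
    rw [Finset.sum_congr rfl h, Finset.sum_const, Finset.card_erase_of_mem (Finset.mem_univ j),
      Finset.card_univ, Fintype.card_fin, ← Nat.cast_smul_eq_nsmul ℝ, smul_smul,
      Nat.cast_sub (by linarith [hid.two_le]), Nat.cast_one, inv_mul_cancel₀ hk, one_smul]
  | covariates =>
    simp only [eta1Formula, trueXi_eta1]
    congr 1
    ext r
    have hpos := (hid.of_covariates rfl).1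
    have h2 := (sigZX_transpose_mul_pos hid rfl r).ne'
    rw [sigZXstar_transpose_mul hm h4, inv_mul_cancel_left₀ h2, Real.sqrt_sq (hpos j r).le]

/-- Each summand is `Σ_XX Hⱼ`: the left factor `Hₗ` of `Hₗ Σ_XX Hⱼ` is the identity for `l ∈ J1`,
and is cancelled by its inverse in the other scheme. -/
theorem sigXXstarFormula_trueXi {c : Scheme} (hid : Identifiable c P S M) (j : Fin k) :
    sigXXstarFormula c M (trueXi P S M) j = (trueXi P S M).sigXXstar j := by
  have hk : ((k : ℝ) - 1) ≠ 0 := by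
    have : (2 : ℝ) ≤ k := by exact_mod_cast hid.two_le
    linarith
  cases c with
  | proxies =>
    have h (l : Fin k) (hl : l ∈ M.J1.erase j) : (trueXi P S M).sig l j =
        (trueXi P S M).sigXXstar j := by
      rw [sig_eq_of_ne hm h4 (Finset.ne_of_mem_erase hl),
        hm.eta1_of_mem l (Finset.mem_of_mem_erase hl), sigXXstar_eq hm h4]
      simp
    -- Erasing `j` removes at most one element, so `|J1| > 1` leaves a nonempty index set.
    have hc : ((M.J1.erase j).card : ℝ) ≠ 0 := by
      have h1 := (hid.of_proxies rfl).1
      have h2 := Finset.pred_card_le_card_erase (s := M.J1) (a := j)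
      have : 0 < (M.J1.erase j).card := by omega
      positivity
    simp only [sigXXstarFormula]
    rw [Finset.sum_congr rfl h, Finset.sum_const, ← Nat.cast_smul_eq_nsmul ℝ, smul_smul,
      inv_mul_cancel₀ hc, one_smul]
  | covariates =>
    have h (l : Fin k) (hl : l ∈ Finset.univ.erase j) : ((trueXi P S M).eta1 l)⁻¹ *
        (trueXi P S M).sig l j = (trueXi P S M).sigXXstar j := by
      rw [sig_eq_of_ne hm h4 (Finset.ne_of_mem_erase hl), trueXi_eta1, Matrix.mul_assoc,
        ← sigXXstar_eq hm h4, Matrix.nonsing_inv_mul_cancel_left _ _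
          (isUnit_det_diagonal (hid.eta1_ne_zero l))]
    simp only [sigXXstarFormula]
    rw [Finset.sum_congr rfl h, Finset.sum_const, Finset.card_erase_of_mem (Finset.mem_univ j),
      Finset.card_univ, Fintype.card_fin, ← Nat.cast_smul_eq_nsmul ℝ, smul_smul,
      Nat.cast_sub (by linarith [hid.two_le]), Nat.cast_one, inv_mul_cancel₀ hk, one_smul]

theorem mu_eq (j : Fin k) : (trueXi P S M).mu j =
    M.eta0 j + Matrix.diagonal (M.eta1 j) *ᵥ (trueXi P S M).muX := by
  ext r
  rw [Pi.add_apply, Matrix.mulVec_diagonal]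
  exact hm.trueXi_mu h4 j r

/-- Every proxy with zero intercept contributes exactly `μ_X`, after division by its slope if
necessary, and the two groups together have `|J0|` members. -/
theorem muXFormula_trueXi {c : Scheme} (hid : Identifiable c P S M) :
    muXFormula M (trueXi P S M) = (trueXi P S M).muX := by
  have h1 (j : Fin k) (hj : j ∈ M.J0 ∩ M.J1) : (trueXi P S M).mu j = (trueXi P S M).muX := by
    rw [Finset.mem_inter] at hj
    rw [mu_eq hm h4, hm.eta0_of_mem j hj.1, hm.eta1_of_mem j hj.2]
    simp
  have h2 (j : Fin k) (hj : j ∈ M.J0 \ M.J1) :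
      ((trueXi P S M).eta1 j)⁻¹ *ᵥ (trueXi P S M).mu j = (trueXi P S M).muX := by
    rw [Finset.mem_sdiff] at hj
    rw [mu_eq hm h4, hm.eta0_of_mem j hj.1, zero_add, trueXi_eta1, Matrix.mulVec_mulVec,
      Matrix.nonsing_inv_mul _ (isUnit_det_diagonal (hid.eta1_ne_zero j)), Matrix.one_mulVec]
  have hc : (M.J0.card : ℝ) ≠ 0 := by
    have := hid.J0_nonempty.card_pos
    positivity
  rw [muXFormula, Finset.sum_congr rfl h1, Finset.sum_congr rfl h2, Finset.sum_const,
    Finset.sum_const, ← add_smul, Finset.card_inter_add_card_sdiff, ← Nat.cast_smul_eq_nsmul ℝ,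
    smul_smul, inv_mul_cancel₀ hc, one_smul]

theorem sigXX_eq_average {c : Scheme} (hid : Identifiable c P S M) :
    (k : ℝ)⁻¹ • ∑ j, (trueXi P S M).sigXXstar j * ((trueXi P S M).eta1 j)⁻¹ =
      (trueXi P S M).sigXX := by
  have h (j : Fin k) (_ : j ∈ Finset.univ) : (trueXi P S M).sigXXstar j *
      ((trueXi P S M).eta1 j)⁻¹ = (trueXi P S M).sigXX := by
    rw [sigXXstar_eq hm h4, trueXi_eta1, Matrix.mul_nonsing_inv_cancel_right _ _
      (isUnit_det_diagonal (hid.eta1_ne_zero j))]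
  have hk : (k : ℝ) ≠ 0 := by
    have := hid.two_le
    positivity
  rw [Finset.sum_congr rfl h, Finset.sum_const, Finset.card_univ, Fintype.card_fin,
    ← Nat.cast_smul_eq_nsmul ℝ, smul_smul, inv_mul_cancel₀ hk, one_smul]

theorem sigZX_eq_average {c : Scheme} (hid : Identifiable c P S M) :
    (M.J1.card : ℝ)⁻¹ • ∑ j ∈ M.J1, (trueXi P S M).sigZXstar j = (trueXi P S M).sigZX := by
  have h (j : Fin k) (hj : j ∈ M.J1) : (trueXi P S M).sigZXstar j = (trueXi P S M).sigZX := by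
    rw [sigZXstar_eq hm h4, hm.eta1_of_mem j hj]
    simp
  have hc : (M.J1.card : ℝ) ≠ 0 := by
    have := hid.J1_nonempty.card_pos
    positivity
  rw [Finset.sum_congr rfl h, Finset.sum_const, ← Nat.cast_smul_eq_nsmul ℝ, smul_smul,
    inv_mul_cancel₀ hc, one_smul]

end TrueParameters

/-! ### Inverses of matrix-valued functions -/

section MatrixInverse

variable {E : Type*} [NormedAddCommGroup E] [NormedSpace ℝ E] {p : ℕ} {x : E}
  {A : E → Matrix (Fin p) (Fin p) ℝ}

theorem differentiableAt_det (hA : ∀ r s, DifferentiableAt ℝ (fun y => A y r s) x) :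
    DifferentiableAt ℝ (fun y => (A y).det) x := by
  simp only [Matrix.det_apply]
  fun_prop

/-- By Cramer's rule an entry of the inverse is a quotient of determinants. Working entrywise
requires no norm on matrices. -/
theorem differentiableAt_inv_apply (hA : ∀ r s, DifferentiableAt ℝ (fun y => A y r s) x)
    (hdet : IsUnit (A x).det) (r s : Fin p) :
    DifferentiableAt ℝ (fun y => (A y)⁻¹ r s) x := by
  simp only [Matrix.inv_def, Ring.inverse_eq_inv', Matrix.smul_apply, smul_eq_mul,
    Matrix.adjugate_apply]
  refine ((differentiableAt_det hA).inv hdet.ne_zero).mul (differentiableAt_det fun a b => ?_)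
  simp only [Matrix.updateRow_apply]
  split_ifs
  · exact differentiableAt_const _
  · exact hA a b

theorem tendsto_matrix_iff {α m n : Type*} {l : Filter α} {f : α → Matrix m n ℝ}
    {B : Matrix m n ℝ} :
    Tendsto f l (𝓝 B) ↔ ∀ i j, Tendsto (fun y => f y i j) l (𝓝 (B i j)) := by
  refine ⟨fun h i j => ((continuous_id.matrix_elem i j).tendsto B).comp h, fun h => ?_⟩
  exact tendsto_pi_nhds.2 fun i => tendsto_pi_nhds.2 fun j => h i j

theorem tendsto_matrix_inv {α : Type*} {l : Filter α} {f : α → Matrix (Fin p) (Fin p) ℝ}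
    {B : Matrix (Fin p) (Fin p) ℝ} (hf : Tendsto f l (𝓝 B)) (hB : IsUnit B.det) :
    Tendsto (fun y => (f y)⁻¹) l (𝓝 B⁻¹) := by
  simp only [Matrix.inv_def, Ring.inverse_eq_inv']
  exact ((((continuous_id.matrix_det).tendsto B).comp hf).inv₀ hB.ne_zero).smul
    (((continuous_id.matrix_adjugate).tendsto B).comp hf)

end MatrixInverse

/-! ### The estimating function of the correction parameters -/

section Correction

variable {Ω : Type*} [MeasurableSpace Ω] {P : Measure Ω} {p q k : ℕ} {S : Subjects Ω p q k}
  {M : ErrorModel p k} {c : Scheme}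

/-- An observation is one fixed measurable function of the primitive variables of its subject, so
independence and the common law are inherited. -/
theorem IsMeasurementErrorModel.isIIDSample (hm : IsMeasurementErrorModel P S M) :
    IsIIDSample P (S.obs M) (S.obsLaw M P) := by
  let φ : ℝ × (Fin p → ℝ) × (Fin q → ℝ) × (Fin k → Fin p → ℝ) → Obs p q k :=
    fun d => (d.1, fun j => M.proxy j d.2.1 (d.2.2.2 j), d.2.2.1)
  have hφ : Measurable φ := by
    refine measurable_fst.prodMk (Measurable.prodMk ?_ (by fun_prop))
    refine measurable_pi_lambda _ fun j => ?_
    exact (M.measurable_proxy j).comp (g := fun d : (Fin p → ℝ) × (Fin p → ℝ) =>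
      M.proxy j d.1 d.2) (f := fun d : ℝ × (Fin p → ℝ) × (Fin q → ℝ) × (Fin k → Fin p → ℝ) =>
        (d.2.1, d.2.2.2 j)) (by fun_prop)
  have hobs (i : ℕ) : S.obs M i =
      φ ∘ fun ω => (S.Y i ω, S.X i ω, S.Z i ω, fun j => S.err i j ω) := rfl
  refine ⟨fun i => ?_, ?_, fun i => ?_⟩
  · rw [hobs]
    refine hφ.comp ((hm.measurable_Y i).prodMk ((hm.measurable_X i).prodMk
      ((hm.measurable_Z i).prodMk (measurable_pi_lambda _ (hm.measurable_err i)))))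
  · exact hm.indep_subjects.comp (fun _ => φ) fun _ => hφ
  · exact ((hm.ident_subjects i).comp hφ).map_eq

theorem IsMeasurementErrorModel.integral_obsLaw (hm : IsMeasurementErrorModel P S M)
    {f : Obs p q k → ℝ} (hf : Measurable f) :
    ∫ y, f y ∂(S.obsLaw M P) = ∫ ω, f (S.obs M 0 ω) ∂P :=
  (hm.isIIDSample.integral_comp hf.aestronglyMeasurable).symm

theorem IsMeasurementErrorModel.memLp_obsLaw (hm : IsMeasurementErrorModel P S M)
    {f : Obs p q k → ℝ} (hf : Measurable f) {r : ENNReal}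
    (h : MemLp (fun ω => f (S.obs M 0 ω)) r P) : MemLp f r (S.obsLaw M P) :=
  (memLp_map_measure_iff hf.aestronglyMeasurable (hm.isIIDSample.measurable 0).aemeasurable).2 h

theorem memLp_obs_covariate (hm : IsMeasurementErrorModel P S M) (h4 : FourthMoments P S)
    (a : Fin q) :
    MemLp (fun y : Obs p q k => y.2.2 a) 4 (S.obsLaw M P) :=
  hm.memLp_obsLaw (by fun_prop) (h4.Z a)

variable [IsProbabilityMeasure P] (hm : IsMeasurementErrorModel P S M) (h4 : FourthMoments P S)

include hm

theorem isProbabilityMeasure_obsLaw : IsProbabilityMeasure (S.obsLaw M P) :=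
  hm.isIIDSample.isProbabilityMeasure

include h4

theorem memLp_obs_proxy (j : Fin k) (r : Fin p) :
    MemLp (fun y : Obs p q k => y.2.1 j r) 4 (S.obsLaw M P) :=
  hm.memLp_obsLaw (by fun_prop) (hm.memLp_Xstar h4 j r)

theorem memLp_gFun (b : XiIdx p q k) :
    MemLp (fun y : Obs p q k => gFun c M y.2.1 y.2.2 (trueXi P S M) b) 2 (S.obsLaw M P) := by
  have := isProbabilityMeasure_obsLaw hm
  have hx (j : Fin k) (r : Fin p) :
      MemLp (fun y : Obs p q k => y.2.1 j r - (trueXi P S M).mu j r) 4 (S.obsLaw M P) :=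
    MemLp.sub (memLp_obs_proxy hm h4 j r) (memLp_const _)
  have hz (a : Fin q) :
      MemLp (fun y : Obs p q k => y.2.2 a - (trueXi P S M).muZ a) 4 (S.obsLaw M P) :=
    MemLp.sub (memLp_obs_covariate hm h4 a) (memLp_const _)
  cases b with
  | mu j r => exact memLp_two_of_four (hx j r)
  | sig j l r s => exact MemLp.sub (memLp_two_mul (hx j r) (hx l s)) (memLp_const _)
  | muZ a => exact memLp_two_of_four (hz a)
  | sigZZ a b => exact MemLp.sub (memLp_two_mul (hz a) (hz b)) (memLp_const _)
  | sigZXstar j a r => exact MemLp.sub (memLp_two_mul (hz a) (hx j r)) (memLp_const _)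
  -- The remaining equations do not involve the observation.
  | _ => exact memLp_const _

/-- Moment equations are centered by the definition of means and covariances. The others are
constant in the data and vanish by the identities among the true parameters. -/
theorem integral_gFun (hid : Identifiable c P S M) (b : XiIdx p q k) :
    ∫ y, gFun c M y.2.1 y.2.2 (trueXi P S M) b ∂(S.obsLaw M P) = 0 := by
  have := isProbabilityMeasure_obsLaw hm
  have hX (j : Fin k) (r : Fin p) :
      Integrable (fun y : Obs p q k => y.2.1 j r) (S.obsLaw M P) :=
    (memLp_obs_proxy hm h4 j r).integrable (by norm_num)
  have hx (j : Fin k) (r : Fin p) :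
      MemLp (fun y : Obs p q k => y.2.1 j r - (trueXi P S M).mu j r) 4 (S.obsLaw M P) :=
    MemLp.sub (memLp_obs_proxy hm h4 j r) (memLp_const _)
  have hZ (a : Fin q) : Integrable (fun y : Obs p q k => y.2.2 a) (S.obsLaw M P) :=
    (memLp_obs_covariate hm h4 a).integrable (by norm_num)
  have hz (a : Fin q) :
      MemLp (fun y : Obs p q k => y.2.2 a - (trueXi P S M).muZ a) 4 (S.obsLaw M P) :=
    MemLp.sub (memLp_obs_covariate hm h4 a) (memLp_const _)
  have hint {f g : Obs p q k → ℝ} (hf : MemLp f 4 (S.obsLaw M P)) (hg : MemLp g 4 (S.obsLaw M P)) :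
      Integrable (fun y => f y * g y) (S.obsLaw M P) :=
    (memLp_two_mul hf hg).integrable (by norm_num)
  have hdet {u v : ℝ} (h : u = v) : ∫ _y : Obs p q k, u - v ∂(S.obsLaw M P) = 0 := by simp [h]
  cases b with
  | mu j r =>
    simp only [gFun]
    rw [integral_sub (hX j r) (integrable_const _), hm.integral_obsLaw (by fun_prop)]
    simp [Xi.mu, trueXi, Subjects.obs]
  | sig j l r s =>
    simp only [gFun]
    rw [integral_sub (hint (hx j r) (hx l s)) (integrable_const _),
      hm.integral_obsLaw (by fun_prop)]
    simp [Xi.mu, Xi.sig, trueXi, Subjects.obs, covariance]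
  | muZ a =>
    simp only [gFun]
    rw [integral_sub (hZ a) (integrable_const _), hm.integral_obsLaw (by fun_prop)]
    simp [Xi.muZ, trueXi, Subjects.obs]
  | sigZZ a b =>
    simp only [gFun]
    rw [integral_sub (hint (hz a) (hz b)) (integrable_const _),
      hm.integral_obsLaw (by fun_prop)]
    simp [Xi.muZ, Xi.sigZZ, trueXi, Subjects.obs, covariance]
  | sigZXstar j a r =>
    simp only [gFun]
    rw [integral_sub (hint (hz a) (hx j r)) (integrable_const _),
      hm.integral_obsLaw (by fun_prop)]
    simp [Xi.muZ, Xi.mu, Xi.sigZXstar, trueXi, Subjects.obs, covariance]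
  | muX r => exact hdet (by rw [muXFormula_trueXi hm h4 hid])
  | sigXX r s => exact hdet (by rw [sigXX_eq_average hm h4 hid])
  | sigZX a r => exact hdet (by rw [sigZX_eq_average hm h4 hid])
  | eta0 j r =>
    refine hdet ?_
    rw [mu_eq hm h4, trueXi_eta1, add_sub_cancel_right]
    rfl
  | eta1 j r s => exact hdet (by rw [eta1Formula_trueXi hm h4 hid])
  | errVar j r s =>
    refine hdet ?_
    rw [sig_self_eq hm h4, trueXi_eta1, add_sub_cancel_left]
  | sigXXstar j r s => exact hdet (by rw [sigXXstarFormula_trueXi hm h4 hid])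

/-- The random components are polynomial in `ξ` with integrable coefficients. The deterministic ones
need only ordinary differentiability, which the identifiability conditions secure for the inverses
and square roots. -/
theorem meanDifferentiableAt_gFun (hid : Identifiable c P S M) (b : XiIdx p q k) :
    MeanDifferentiableAt (S.obsLaw M P)
      (fun y : Obs p q k => fun ξ => gFun c M y.2.1 y.2.2 ξ b) (trueXi P S M) := by
  have := isProbabilityMeasure_obsLaw hm
  have hX (j : Fin k) (r : Fin p) :
      Integrable (fun y : Obs p q k => y.2.1 j r) (S.obsLaw M P) :=
    (memLp_obs_proxy hm h4 j r).integrable (by norm_num)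
  have hZ (a : Fin q) : Integrable (fun y : Obs p q k => y.2.2 a) (S.obsLaw M P) :=
    (memLp_obs_covariate hm h4 a).integrable (by norm_num)
  have hint {f g : Obs p q k → ℝ} (hf : MemLp f 4 (S.obsLaw M P)) (hg : MemLp g 4 (S.obsLaw M P)) :
      Integrable (fun y => f y * g y) (S.obsLaw M P) :=
    (memLp_two_mul hf hg).integrable (by norm_num)
  have hx := memLp_obs_proxy hm h4
  have hz := memLp_obs_covariate hm h4
  have hlin {u : Obs p q k → ℝ} (hu : Integrable u (S.obsLaw M P)) (a : XiIdx p q k) :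
      MeanDifferentiableAt (S.obsLaw M P) (fun y (ξ : Xi p q k) => u y - ξ a) (trueXi P S M) := by
    have h := (MeanDifferentiableAt.mul hu (differentiableAt_const (c := (1 : ℝ)))).add
      (MeanDifferentiableAt.const (L := S.obsLaw M P) (f := fun ξ : Xi p q k => -ξ a)
        (θ₀ := trueXi P S M) (by fun_prop))
    simpa only [mul_one, ← sub_eq_add_neg] using h
  have hquad {u v : Obs p q k → ℝ} (hu : MemLp u 4 (S.obsLaw M P)) (hv : MemLp v 4 (S.obsLaw M P))
      (a b d : XiIdx p q k) : MeanDifferentiableAt (S.obsLaw M P)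
        (fun y (ξ : Xi p q k) => (u y - ξ a) * (v y - ξ b) - ξ d) (trueXi P S M) := by
    -- The product expands as `uv - u ξ_b - v ξ_a + (ξ_a ξ_b - ξ_d)`, which separates data from
    -- parameters.
    have h := (((MeanDifferentiableAt.mul (hint hu hv)
      (differentiableAt_const (x := trueXi P S M) (c := (1 : ℝ)))).add
      (MeanDifferentiableAt.mul (hu.integrable (by norm_num))
        (f := fun ξ : Xi p q k => -ξ b) (by fun_prop))).add
      (MeanDifferentiableAt.mul (hv.integrable (by norm_num))
        (f := fun ξ : Xi p q k => -ξ a) (by fun_prop))).add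
      (MeanDifferentiableAt.const (f := fun ξ : Xi p q k => ξ a * ξ b - ξ d) (by fun_prop))
    convert h using 3
    ring
  have hap (b : XiIdx p q k) : DifferentiableAt ℝ (fun ξ : Xi p q k => ξ b) (trueXi P S M) :=
    differentiableAt_apply b _
  have hinv (j : Fin k) (r s : Fin p) :
      DifferentiableAt ℝ (fun ξ : Xi p q k => (ξ.eta1 j)⁻¹ r s) (trueXi P S M) :=
    differentiableAt_inv_apply (A := fun ξ : Xi p q k => ξ.eta1 j)
      (fun r s => differentiableAt_apply (XiIdx.eta1 j r s) _)
      (x := trueXi P S M) (isUnit_det_diagonal (hid.eta1_ne_zero j)) r s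
  cases b with
  | mu j r => exact hlin (hX j r) (.mu j r)
  | sig j l r s => exact hquad (hx j r) (hx l s) (.mu j r) (.mu l s) (.sig j l r s)
  | muZ a => exact hlin (hZ a) (.muZ a)
  | sigZZ a b => exact hquad (hz a) (hz b) (.muZ a) (.muZ b) (.sigZZ a b)
  | sigZXstar j a r => exact hquad (hz a) (hx j r) (.muZ a) (.mu j r) (.sigZXstar j a r)
  | muX r =>
    simp only [gFun, muXFormula, Pi.smul_apply, Pi.add_apply, Finset.sum_apply, smul_eq_mul,
      Matrix.mulVec, dotProduct, Xi.mu, Xi.muX]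
    exact .const ((((DifferentiableAt.fun_sum fun j _ => hap _).fun_add
      (DifferentiableAt.fun_sum fun j _ => DifferentiableAt.fun_sum fun t _ =>
        (hinv j r t).fun_mul (hap _))).const_mul _).fun_sub (hap _))
  | sigXX r s =>
    simp only [gFun, Matrix.smul_apply, Matrix.sum_apply, Matrix.mul_apply, smul_eq_mul,
      Xi.sigXXstar, Xi.sigXX, Matrix.of_apply]
    exact .const (((DifferentiableAt.fun_sum fun j _ => DifferentiableAt.fun_sum fun t _ =>
      (hap _).fun_mul (hinv j t s)).const_mul _).fun_sub (hap _))
  | sigZX a r =>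
    simp only [gFun, Matrix.smul_apply, Matrix.sum_apply, smul_eq_mul, Xi.sigZXstar, Xi.sigZX,
      Matrix.of_apply]
    refine .const ?_
    fun_prop
  | eta0 j r =>
    simp only [gFun, Pi.sub_apply, Matrix.mulVec, dotProduct, Xi.mu, Xi.eta1, Xi.muX, Xi.eta0,
      Matrix.of_apply]
    refine .const ?_
    fun_prop
  | errVar j r s =>
    simp only [gFun, Matrix.sub_apply, Matrix.mul_apply, Xi.sig, Xi.eta1, Xi.sigXX, Xi.errVar,
      Matrix.of_apply]
    refine .const ?_
    fun_prop
  | eta1 j r s =>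
    cases c with
    | proxies =>
      have hinv' (j : Fin k) (r s : Fin p) :
          DifferentiableAt ℝ (fun ξ : Xi p q k => (ξ.sigXXstar j)⁻¹ r s) (trueXi P S M) :=
        differentiableAt_inv_apply (A := fun ξ : Xi p q k => ξ.sigXXstar j)
          (fun r s => hap (XiIdx.sigXXstar j r s)) (x := trueXi P S M)
          (isUnit_det_sigXXstar hm h4 hid rfl j) r s
      simp only [gFun, eta1Formula, Matrix.smul_apply, Matrix.sum_apply, Matrix.mul_apply,
        smul_eq_mul, Xi.sig, Xi.eta1, Matrix.of_apply]
      exact .const (((DifferentiableAt.fun_sum fun l _ => DifferentiableAt.fun_sum fun t _ =>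
        (hap _).fun_mul (hinv' l t s)).const_mul _).fun_sub (hap _))
    | covariates =>
      have h1 := sigZX_transpose_mul_pos hid rfl r
      have h2 : 0 < (((trueXi P S M).sigZXstar j)ᵀ * (trueXi P S M).sigZXstar j) r r := by
        rw [sigZXstar_transpose_mul hm h4]
        have := (hid.of_covariates rfl).1 j r
        positivity
      have h3 : DifferentiableAt ℝ (fun ξ : Xi p q k =>
          √(((ξ.sigZXᵀ * ξ.sigZX) r r)⁻¹ * ((ξ.sigZXstar j)ᵀ * ξ.sigZXstar j) r r))
          (trueXi P S M) := by
        -- The argument of the root is strictly positive at the true parameter, so the singularity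
        -- at zero is avoided.
        refine DifferentiableAt.sqrt (DifferentiableAt.mul (DifferentiableAt.inv ?_ h1.ne') ?_)
          (mul_pos (inv_pos.2 h1) h2).ne'
        · simp only [Matrix.mul_apply, Matrix.transpose_apply, Xi.sigZX, Matrix.of_apply]
          fun_prop
        · simp only [Matrix.mul_apply, Matrix.transpose_apply, Xi.sigZXstar, Matrix.of_apply]
          fun_prop
      simp only [gFun, eta1Formula, Matrix.diagonal_apply, Xi.eta1, Matrix.of_apply]
      split_ifs
      · exact .const (h3.sub (differentiableAt_apply _ _))
      · exact .const (by fun_prop)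
  | sigXXstar j r s =>
    cases c with
    | proxies =>
      simp only [gFun, sigXXstarFormula, Matrix.smul_apply, Matrix.sum_apply, smul_eq_mul, Xi.sig,
        Xi.sigXXstar, Matrix.of_apply]
      refine .const ?_
      fun_prop
    | covariates =>
      simp only [gFun, sigXXstarFormula, Matrix.smul_apply, Matrix.sum_apply, Matrix.mul_apply,
        smul_eq_mul, Xi.sig, Xi.sigXXstar, Matrix.of_apply]
      exact .const (((DifferentiableAt.fun_sum fun l _ => DifferentiableAt.fun_sum fun t _ =>
        (hinv l r t).fun_mul (hap _)).const_mul _).fun_sub (hap _))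

/-- Solutions of the empirical correction equations are consistent. -/
theorem tendsto_of_sampleMean_gFun_eq_zero (hid : Identifiable c P S M) {ξ : ℕ × Ω → Xi p q k}
    (hξ : ∀ᶠ x in inProbability P, ∀ b,
      sampleMean (S.obs M) (fun y => gFun c M y.2.1 y.2.2 (ξ x) b) x = 0) :
    Tendsto ξ (inProbability P) (𝓝 (trueXi P S M)) := by
  have hs := hm.isIIDSample
  have hx := memLp_obs_proxy hm h4
  have hz := memLp_obs_covariate hm h4
  have hn : ∀ᶠ x in inProbability P, x.1 ≠ 0 :=
    eventually_inProbability_of_atTop (p := fun n => n ≠ 0) (eventually_ne_atTop 0)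
  -- components that are sample moments
  have hlin {u : Obs p q k → ℝ} (hu : MemLp u 4 (S.obsLaw M P)) {a : XiIdx p q k}
      (ha : ∀ (y : Obs p q k) ξ, gFun c M y.2.1 y.2.2 ξ a = u y - ξ a) :
      Tendsto (fun x => ξ x a) (inProbability P) (𝓝 (∫ y, u y ∂(S.obsLaw M P))) := by
    have := isProbabilityMeasure_obsLaw hm
    refine (hs.tendsto_sampleMean (hu.integrable (by norm_num))).congr' ?_
    filter_upwards [hξ, hn] with x hx hxn
    have := hx a
    simp only [ha] at this
    rw [sampleMean_sub, sampleMean_const hxn] at this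
    linarith
  -- The empirical covariance is centered at estimated means. Expanding the product leaves sample
  -- moments and those estimates, all of which converge.
  have hquad {u v : Obs p q k → ℝ} (hu : MemLp u 4 (S.obsLaw M P))
      (hv : MemLp v 4 (S.obsLaw M P)) {a b d : XiIdx p q k}
      (ha : Tendsto (fun x => ξ x a) (inProbability P) (𝓝 (∫ y, u y ∂(S.obsLaw M P))))
      (hb : Tendsto (fun x => ξ x b) (inProbability P) (𝓝 (∫ y, v y ∂(S.obsLaw M P))))
      (hd : ∀ (y : Obs p q k) ξ, gFun c M y.2.1 y.2.2 ξ d = (u y - ξ a) * (v y - ξ b) - ξ d) :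
      Tendsto (fun x => ξ x d) (inProbability P) (𝓝 (cov[u, v; S.obsLaw M P])) := by
    have := isProbabilityMeasure_obsLaw hm
    rw [covariance_eq_sub (memLp_two_of_four hu) (memLp_two_of_four hv)]
    have h1 := hs.tendsto_sampleMean ((memLp_two_mul hu hv).integrable (by norm_num))
    have h2 := hs.tendsto_sampleMean (hu.integrable (by norm_num))
    have h3 := hs.tendsto_sampleMean (hv.integrable (by norm_num))
    have h := (((h1.sub (h2.mul hb)).sub (ha.mul h3)).add (ha.mul hb))
    rw [sub_add_cancel] at h
    refine h.congr' ?_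
    filter_upwards [hξ, hn] with x hx hxn
    have := hx d
    have he (y : Obs p q k) : gFun c M y.2.1 y.2.2 (ξ x) d =
        u y * v y - u y * ξ x b - ξ x a * v y + ξ x a * ξ x b - ξ x d := by
      rw [hd]; ring
    simp only [he, sampleMean_sub, sampleMean_add, sampleMean_mul_const, sampleMean_const_mul,
      sampleMean_const hxn] at this
    linarith
  -- A nonrandom equation forces `ξ a = G ξ` exactly once `n ≠ 0`, so convergence of `G ξ` carries
  -- over to this coordinate.
  have hdet {a : XiIdx p q k} {G : Xi p q k → ℝ} {t : ℝ}
      (ha : ∀ (y : Obs p q k) ξ, gFun c M y.2.1 y.2.2 ξ a = G ξ - ξ a)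
      (hG : Tendsto (fun x => G (ξ x)) (inProbability P) (𝓝 t)) (ht : t = trueXi P S M a) :
      Tendsto (fun x => ξ x a) (inProbability P) (𝓝 (trueXi P S M a)) := by
    rw [← ht]
    refine hG.congr' ?_
    filter_upwards [hξ, hn] with x hx hxn
    have := hx a
    simp only [ha, sampleMean_const hxn] at this
    linarith
  have hintX (j : Fin k) (r : Fin p) :
      ∫ y : Obs p q k, y.2.1 j r ∂(S.obsLaw M P) = trueXi P S M (.mu j r) :=
    hm.integral_obsLaw (by fun_prop)
  have hintZ (a : Fin q) :
      ∫ y : Obs p q k, y.2.2 a ∂(S.obsLaw M P) = trueXi P S M (.muZ a) :=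
    hm.integral_obsLaw (by fun_prop)
  have hcov {u v : Obs p q k → ℝ} (hu : Measurable u) (hv : Measurable v) :
      cov[u, v; S.obsLaw M P] =
        cov[fun ω => u (S.obs M 0 ω), fun ω => v (S.obs M 0 ω); P] :=
    covariance_map hu.aestronglyMeasurable hv.aestronglyMeasurable
      (hs.measurable 0).aemeasurable
  have hmu (j : Fin k) (r : Fin p) := hlin (hx j r) (a := .mu j r) fun _ _ => rfl
  have hmuZ (a : Fin q) := hlin (hz a) (a := .muZ a) fun _ _ => rfl
  have hsig (j l : Fin k) : Tendsto (fun x => (ξ x).sig j l) (inProbability P)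
      (𝓝 ((trueXi P S M).sig j l)) := by
    refine tendsto_matrix_iff.2 fun r s => ?_
    have h := hquad (hx j r) (hx l s) (hmu j r) (hmu l s) (d := .sig j l r s) fun _ _ => rfl
    rwa [hcov (by fun_prop) (by fun_prop)] at h
  have hsigZZ (a b : Fin q) : Tendsto (fun x => ξ x (.sigZZ a b)) (inProbability P)
      (𝓝 (trueXi P S M (.sigZZ a b))) := by
    have h := hquad (hz a) (hz b) (hmuZ a) (hmuZ b) (d := .sigZZ a b) fun _ _ => rfl
    rwa [hcov (by fun_prop) (by fun_prop)] at h
  have hsigZXstar (j : Fin k) : Tendsto (fun x => (ξ x).sigZXstar j) (inProbability P)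
      (𝓝 ((trueXi P S M).sigZXstar j)) := by
    refine tendsto_matrix_iff.2 fun a r => ?_
    have h := hquad (hz a) (hx j r) (hmuZ a) (hmu j r) (d := .sigZXstar j a r) fun _ _ => rfl
    rwa [hcov (by fun_prop) (by fun_prop)] at h
  have hmu' (j : Fin k) : Tendsto (fun x => (ξ x).mu j) (inProbability P)
      (𝓝 ((trueXi P S M).mu j)) := by
    refine tendsto_pi_nhds.2 fun r => ?_
    have := hmu j r
    rwa [hintX] at this
  have hsigZX : Tendsto (fun x => (ξ x).sigZX) (inProbability P) (𝓝 (trueXi P S M).sigZX) := by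
    have h := (tendsto_finsetSum M.J1 fun j _ => hsigZXstar j).const_smul ((M.J1.card : ℝ)⁻¹)
    refine tendsto_matrix_iff.2 fun a r => ?_
    exact hdet (a := .sigZX a r) (fun _ _ => rfl) (tendsto_matrix_iff.1 h a r)
      (by rw [sigZX_eq_average hm h4 hid]; rfl)
  -- the slopes and the covariances of the covariate with the proxies
  have hmul {f g : ℕ × Ω → Matrix (Fin p) (Fin p) ℝ} {A B : Matrix (Fin p) (Fin p) ℝ}
      (hf : Tendsto f (inProbability P) (𝓝 A)) (hg : Tendsto g (inProbability P) (𝓝 B)) :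
      Tendsto (fun x => f x * g x) (inProbability P) (𝓝 (A * B)) := hf.mul hg
  have hunit (j : Fin k) : IsUnit ((trueXi P S M).eta1 j).det :=
    isUnit_det_diagonal (hid.eta1_ne_zero j)
  have hboth : (∀ j, Tendsto (fun x => (ξ x).eta1 j) (inProbability P)
      (𝓝 ((trueXi P S M).eta1 j))) ∧ ∀ j, Tendsto (fun x => (ξ x).sigXXstar j) (inProbability P)
      (𝓝 ((trueXi P S M).sigXXstar j)) := by
    have key : (∀ j, Tendsto (fun x => eta1Formula c (ξ x) j) (inProbability P)
        (𝓝 (eta1Formula c (trueXi P S M) j))) → ∀ j, Tendsto (fun x => (ξ x).eta1 j)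
        (inProbability P) (𝓝 ((trueXi P S M).eta1 j)) := fun h j =>
      tendsto_matrix_iff.2 fun r s => hdet (a := .eta1 j r s) (fun _ _ => rfl)
        (tendsto_matrix_iff.1 (h j) r s) (by rw [eta1Formula_trueXi hm h4 hid]; rfl)
    have key' : (∀ j, Tendsto (fun x => sigXXstarFormula c M (ξ x) j) (inProbability P)
        (𝓝 (sigXXstarFormula c M (trueXi P S M) j))) → ∀ j,
        Tendsto (fun x => (ξ x).sigXXstar j)
        (inProbability P) (𝓝 ((trueXi P S M).sigXXstar j)) := fun h j =>
      tendsto_matrix_iff.2 fun r s => hdet (a := .sigXXstar j r s) (fun _ _ => rfl)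
        (tendsto_matrix_iff.1 (h j) r s) (by rw [sigXXstarFormula_trueXi hm h4 hid]; rfl)
    -- The two schemes resolve the mutual dependence in opposite orders: the first obtains
    -- `Σ_{XX*ⱼ}` from proxy covariances and then the slopes, the second obtains the slopes from `Z`
    -- and then `Σ_{XX*ⱼ}`.
    cases c with
    | proxies =>
      have h1 := key' fun j => (tendsto_finsetSum (M.J1.erase j) fun l _ =>
        hsig l j).const_smul (((M.J1.erase j).card : ℝ)⁻¹)
      exact ⟨key fun j => (tendsto_finsetSum (Finset.univ.erase j) fun l _ => hmul (hsig j l)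
        (tendsto_matrix_inv (h1 l) (isUnit_det_sigXXstar hm h4 hid rfl l))).const_smul
          (((k : ℝ) - 1)⁻¹), h1⟩
    | covariates =>
      have h1 := key fun j => by
        refine tendsto_matrix_iff.2 fun r s => ?_
        have hgram {f : ℕ × Ω → Matrix (Fin q) (Fin p) ℝ} {A : Matrix (Fin q) (Fin p) ℝ}
            (hf : Tendsto f (inProbability P) (𝓝 A)) :
            Tendsto (fun x => ((f x)ᵀ * f x) r r) (inProbability P) (𝓝 ((Aᵀ * A) r r)) := by
          simp only [Matrix.mul_apply, Matrix.transpose_apply]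
          exact tendsto_finsetSum _ fun a _ =>
            (tendsto_matrix_iff.1 hf a r).mul (tendsto_matrix_iff.1 hf a r)
        have h := ((hgram hsigZX).inv₀ (sigZX_transpose_mul_pos hid rfl r).ne').mul
          (hgram (hsigZXstar j))
        simp only [eta1Formula, Matrix.diagonal_apply]
        split_ifs
        · exact h.sqrt
        · exact tendsto_const_nhds
      exact ⟨h1, key' fun j => (tendsto_finsetSum (Finset.univ.erase j) fun l _ =>
        hmul (tendsto_matrix_inv (h1 l) (hunit l)) (hsig l j)).const_smul (((k : ℝ) - 1)⁻¹)⟩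
  obtain ⟨heta1, hsigXXstar⟩ := hboth
  have hmv {f : ℕ × Ω → Matrix (Fin p) (Fin p) ℝ} {A : Matrix (Fin p) (Fin p) ℝ}
      {g : ℕ × Ω → Fin p → ℝ} {v : Fin p → ℝ} (hf : Tendsto f (inProbability P) (𝓝 A))
      (hg : Tendsto g (inProbability P) (𝓝 v)) :
      Tendsto (fun x => f x *ᵥ g x) (inProbability P) (𝓝 (A *ᵥ v)) := by
    refine tendsto_pi_nhds.2 fun r => ?_
    simp only [Matrix.mulVec, dotProduct]
    refine tendsto_finsetSum _ fun s _ => ?_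
    exact (tendsto_matrix_iff.1 hf r s).mul (tendsto_pi_nhds.1 hg s)
  have hmuX : Tendsto (fun x => (ξ x).muX) (inProbability P) (𝓝 (trueXi P S M).muX) := by
    have h : Tendsto (fun x => muXFormula M (ξ x)) (inProbability P)
        (𝓝 (muXFormula M (trueXi P S M))) :=
      ((tendsto_finsetSum _ fun j _ => hmu' j).add (tendsto_finsetSum _ fun j _ =>
        hmv (tendsto_matrix_inv (heta1 j) (hunit j)) (hmu' j))).const_smul _
    refine tendsto_pi_nhds.2 fun r => ?_
    exact hdet (a := .muX r) (fun _ _ => rfl) (tendsto_pi_nhds.1 h r)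
      (by rw [muXFormula_trueXi hm h4 hid]; rfl)
  have hsigXX : Tendsto (fun x => (ξ x).sigXX) (inProbability P) (𝓝 (trueXi P S M).sigXX) := by
    have h := (tendsto_finsetSum (Finset.univ : Finset (Fin k)) fun j _ => hmul (hsigXXstar j)
      (tendsto_matrix_inv (heta1 j) (hunit j))).const_smul ((k : ℝ)⁻¹)
    refine tendsto_matrix_iff.2 fun r s => ?_
    exact hdet (a := .sigXX r s) (fun _ _ => rfl) (tendsto_matrix_iff.1 h r s)
      (by rw [sigXX_eq_average hm h4 hid]; rfl)
  refine tendsto_pi_nhds.2 fun b => ?_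
  cases b with
  | mu j r => exact tendsto_pi_nhds.1 (hmu' j) r
  | sig j l r s => exact tendsto_matrix_iff.1 (hsig j l) r s
  | muZ a =>
    have := hmuZ a
    rwa [hintZ] at this
  | sigZZ a b => exact hsigZZ a b
  | sigZXstar j a r => exact tendsto_matrix_iff.1 (hsigZXstar j) a r
  | muX r => exact tendsto_pi_nhds.1 hmuX r
  | sigXX r s => exact tendsto_matrix_iff.1 hsigXX r s
  | sigZX a r => exact tendsto_matrix_iff.1 hsigZX a r
  | eta0 j r =>
    refine hdet (a := .eta0 j r) (fun _ _ => rfl)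
      (tendsto_pi_nhds.1 ((hmu' j).sub (hmv (heta1 j) hmuX)) r) ?_
    rw [mu_eq hm h4, trueXi_eta1, add_sub_cancel_right]
    rfl
  | eta1 j r s => exact tendsto_matrix_iff.1 (heta1 j) r s
  | errVar j r s =>
    refine hdet (a := .errVar j r s) (fun _ _ => rfl) (tendsto_matrix_iff.1
      ((hsig j j).sub (hmul (hmul (heta1 j) hsigXX) (heta1 j))) r s) ?_
    rw [sig_self_eq hm h4, trueXi_eta1, add_sub_cancel_left]
    rfl
  | sigXXstar j r s => exact tendsto_matrix_iff.1 (hsigXXstar j) r s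

end Correction

/-! ### The equations of the predictor -/

section Predictor

variable {p q k : ℕ}

theorem contDiff_hFun (w : Weighting k) (t : TauIdx p q k) :
    ContDiff ℝ 1 fun u : Tau p q k × Xi p q k => hFun w u.1 u.2 t := by
  have hτ (t : TauIdx p q k) : ContDiff ℝ 1 fun u : Tau p q k × Xi p q k => u.1 t := by fun_prop
  have hξ (b : XiIdx p q k) : ContDiff ℝ 1 fun u : Tau p q k × Xi p q k => u.2 b := by fun_prop
  have hres (j : Fin k) (r s : Fin p) :
      ContDiff ℝ 1 fun u : Tau p q k × Xi p q k => residCov u.1 u.2 j r s := by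
    simp only [residCov, Matrix.sub_apply, Matrix.mul_apply, Matrix.sum_apply, Matrix.smul_apply,
      smul_eq_mul, Xi.sigXXstar, Xi.sig, Xi.sigZXstar, Tau.beta, Tau.gamma, Tau.alpha,
      Matrix.of_apply]
    fun_prop
  cases t with
  | mu r =>
    simp only [hFun, Pi.sub_apply, Matrix.mulVec, dotProduct, Finset.sum_apply, Pi.smul_apply,
      smul_eq_mul, Xi.muX, Xi.mu, Xi.muZ, Tau.mu, Tau.beta, Tau.gamma, Tau.alpha, Matrix.of_apply]
    fun_prop
  | beta r s =>
    simp only [hFun, Matrix.sum_apply, Matrix.smul_apply, smul_eq_mul, Tau.alpha]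
    exact ContDiff.sum fun j _ => (hτ _).mul (hres j r s)
  | gamma r a =>
    simp only [hFun, Matrix.sub_apply, Matrix.mul_apply, Matrix.sum_apply, Matrix.smul_apply,
      Matrix.transpose_apply, smul_eq_mul, Xi.sigZX, Xi.sigZXstar, Xi.sigZZ, Tau.beta, Tau.gamma,
      Tau.alpha, Matrix.of_apply]
    fun_prop
  | alpha j =>
    cases w with
    | fixed a₀ =>
      simp only [hFun, Tau.alpha]
      fun_prop
    | optimal =>
      simp only [hFun, Matrix.trace, Matrix.diag_apply, Matrix.mul_apply, Matrix.transpose_apply,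
        Tau.beta, Tau.lam, Matrix.of_apply]
      exact (ContDiff.sum fun r _ => ContDiff.sum fun s _ => (hτ _).mul (hres j s r)).sub (hτ _)
  | lam =>
    cases w with
    | fixed a₀ =>
      simp only [hFun, Tau.lam]
      fun_prop
    | optimal =>
      simp only [hFun, Tau.alpha]
      fun_prop

theorem continuous_hFun (w : Weighting k) :
    Continuous fun u : Tau p q k × Xi p q k => hFun w u.1 u.2 :=
  continuous_pi fun t => (contDiff_hFun w t).continuous

/-- Solutions of the predictor equations are consistent. -/
theorem tendsto_of_hFun_eq_zero {α : Type*} {l : Filter α} {w : Weighting k}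
    {K : Set (Tau p q k)} (hK : IsCompact K) {τ₀ : Tau p q k} {ξ₀ : Xi p q k}
    (huniq : ∀ τ ∈ K, hFun w τ ξ₀ = 0 → τ = τ₀) {τ : α → Tau p q k} {ξ : α → Xi p q k}
    (hξ : Tendsto ξ l (𝓝 ξ₀)) (hτ : ∀ᶠ x in l, τ x ∈ K)
    (hroot : ∀ᶠ x in l, hFun w (τ x) (ξ x) = 0) : Tendsto τ l (𝓝 τ₀) := by
  -- In a compact set it suffices that `τ₀` is the only cluster point. An ultrafilter along which
  -- `τ` tends to the cluster point plays the role of a subsequence.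
  refine hK.tendsto_nhds_of_unique_mapClusterPt hτ fun t htK ht => huniq t htK ?_
  obtain ⟨U, hUl, hU⟩ := mapClusterPt_iff_ultrafilter.1 ht
  have h := ((continuous_hFun w).tendsto (t, ξ₀)).comp (hU.prodMk_nhds (hξ.mono_left hUl))
  refine tendsto_nhds_unique h (tendsto_const_nhds.congr' ?_)
  filter_upwards [hroot.filter_mono hUl] with x hx
  exact hx.symm

end Predictor

/-! ### Dominated estimating functions -/

section Dominated

variable {O E : Type*} [MeasurableSpace O] {L : Measure O} [NormedAddCommGroup E]
  [NormedSpace ℝ E] [SecondCountableTopology E]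

/-- The remainder divided by `‖t - t₀‖` tends to zero by differentiability, and the mean value
inequality bounds it by `2F`. `exists_integrable_modulus` then provides the dominating function of
small integral. -/
theorem MeanDifferentiableAt.of_dominated {f : O → E → ℝ} {F : O → ℝ} {U : Set E} {t₀ : E}
    (hU : IsOpen U) (ht₀ : t₀ ∈ U) (hmeas : ∀ t, AEMeasurable (fun y => f y t) L)
    (hF : Integrable F L)
    (hae : ∀ᵐ y ∂L, DifferentiableOn ℝ (f y) U ∧ ∀ t ∈ U, ‖fderiv ℝ (f y) t‖ ≤ F y) :
    MeanDifferentiableAt L f t₀ := by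
  have hdiff : ∀ᵐ y ∂L, DifferentiableAt ℝ (f y) t₀ := by
    filter_upwards [hae] with y hy
    exact hy.1.differentiableAt (hU.mem_nhds ht₀)
  have hdm (v : E) : AEMeasurable (fun y => fderiv ℝ (f y) t₀ v) L := by
    -- The directional derivative is measurable as an almost everywhere limit of difference
    -- quotients.
    refine aemeasurable_of_tendsto_metrizable_ae atTop
      (f := fun (n : ℕ) y => ((n : ℝ) + 1) * (f y (t₀ + ((n : ℝ) + 1)⁻¹ • v) - f y t₀))
      (fun n => ((hmeas _).sub (hmeas _)).const_mul _) ?_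
    filter_upwards [hdiff] with y hy
    have hl : Tendsto (fun n : ℕ => ‖(n : ℝ) + 1‖) atTop atTop := by
      refine tendsto_norm_atTop_atTop.comp ?_
      exact tendsto_atTop_add_const_right _ _ tendsto_natCast_atTop_atTop
    have := hy.hasFDerivAt.lim v (c := fun n : ℕ => (n : ℝ) + 1) (l := atTop) hl
    simpa using this
  have hF0 : ∀ᵐ y ∂L, 0 ≤ F y := by
    filter_upwards [hae] with y hy
    exact (norm_nonneg _).trans (hy.2 t₀ ht₀)
  refine ⟨hdiff, fun v => ?_, fun ε hε => ?_⟩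
  · refine (hF.mul_const ‖v‖).mono' (hdm v).aestronglyMeasurable ?_
    filter_upwards [hae] with y hy
    refine ((fderiv ℝ (f y) t₀).le_opNorm v).trans ?_
    gcongr
    exact hy.2 t₀ ht₀
  · obtain ⟨ρ, hρ, hball⟩ := Metric.isOpen_iff.1 hU t₀ ht₀
    -- A ball is convex, as the mean value inequality requires. Its center is removed so that the
    -- quotient is continuous on `s`; at the center the remainder is zero anyway.
    let s : Set E := Metric.ball t₀ ρ \ {t₀}
    let R : O → E → ℝ := fun y t =>
      ‖t - t₀‖⁻¹ * |f y t - f y t₀ - fderiv ℝ (f y) t₀ (t - t₀)|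
    have hmod := exists_integrable_modulus (L := L) (f := R) (F := fun y => 2 * F y) (s := s)
      (t₀ := t₀) (hF.const_mul 2) (fun t _ => ?_) ?_ hε
    · obtain ⟨δ, hδ, w, hw0, hwi, hwε, hw⟩ := hmod
      refine ⟨min δ ρ, lt_min hδ hρ, w, hw0, hwi, hwε, ?_⟩
      filter_upwards [hw] with y hy t ht
      rcases eq_or_ne t t₀ with rfl | hne
      · simp
      have hpos : 0 < ‖t - t₀‖ := norm_pos_iff.2 (sub_ne_zero.2 hne)
      have h := hy t ⟨ht.trans_le (min_le_right _ _), hne⟩ (ht.trans_le (min_le_left _ _))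
      simp only [R] at h
      rwa [inv_mul_le_iff₀ hpos, mul_comm] at h
    · exact (((hmeas t).sub (hmeas t₀)).sub (hdm (t - t₀))).abs.const_mul _
    · filter_upwards [hae, hdiff, hF0] with y hy hyd hy0
      have hcont : ContinuousOn (f y) U := hy.1.continuousOn
      refine ⟨?_, fun t ht => ?_, ?_⟩
      · refine ContinuousOn.mul (ContinuousOn.inv₀ (by fun_prop) fun t ht =>
          norm_ne_zero_iff.2 (sub_ne_zero.2 ht.2)) ?_
        refine ContinuousOn.abs (((hcont.mono (Set.sdiff_subset.trans hball)).sub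
          continuousOn_const).sub (by fun_prop))
      · have hpos : 0 < ‖t - t₀‖ := norm_pos_iff.2 (sub_ne_zero.2 ht.2)
        have h1 : ‖f y t - f y t₀‖ ≤ F y * ‖t - t₀‖ :=
          (convex_ball t₀ ρ).norm_image_sub_le_of_norm_fderiv_le
            (fun z hz => hy.1.differentiableAt (hU.mem_nhds (hball hz)))
            (fun z hz => hy.2 z (hball hz)) (Metric.mem_ball_self hρ) ht.1
        have h2 : ‖fderiv ℝ (f y) t₀ (t - t₀)‖ ≤ F y * ‖t - t₀‖ := by
          refine ((fderiv ℝ (f y) t₀).le_opNorm _).trans ?_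
          gcongr
          exact hy.2 t₀ ht₀
        simp only [R]
        rw [inv_mul_le_iff₀ hpos, ← Real.norm_eq_abs]
        refine (norm_sub_le _ _).trans ?_
        linarith
      · exact (hasFDerivAt_iff_tendsto.1 hyd.hasFDerivAt).mono_left nhdsWithin_le_nhds

end Dominated

/-! ### Consistency with an estimated nuisance parameter -/

section Consistency

variable {Ω O A B ι : Type*} [MeasurableSpace Ω] [MeasurableSpace O] {P : Measure Ω}
  [IsProbabilityMeasure P] {o : ℕ → Ω → O} {L : Measure O} [PseudoMetricSpace A]
  [SecondCountableTopology A] [PseudoMetricSpace B] [SecondCountableTopology B]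

/-- Consistency of a root of an estimating equation with a plugged-in consistent estimator of a
nuisance parameter. -/
theorem tendsto_of_sampleMean_eq_zero {ψ : O → A → B → ι → ℝ} {F : O → ℝ} {K : Set A}
    {V : Set B} {a₀ : A} {b₀ : B} (hs : IsIIDSample P o L) (hK : IsCompact K) (hV : IsOpen V)
    (hb₀ : b₀ ∈ V) (hmeas : ∀ a b i, Measurable fun y => ψ y a b i) (hF : Integrable F L)
    (hae : ∀ᵐ y ∂L, ∀ i, ContinuousOn (fun t : A × B => ψ y t.1 t.2 i) (K ×ˢ V) ∧
      ∀ a ∈ K, ∀ b ∈ V, |ψ y a b i| ≤ F y)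
    (huniq : ∀ a ∈ K, (∀ i, ∫ y, ψ y a b₀ i ∂L = 0) → a = a₀) {ahat : ℕ × Ω → A}
    {bhat : ℕ × Ω → B} (hb : Tendsto bhat (inProbability P) (𝓝 b₀))
    (ha : ∀ᶠ x in inProbability P, ahat x ∈ K)
    (hroot : ∀ᶠ x in inProbability P, ∀ i,
      sampleMean o (fun y => ψ y (ahat x) (bhat x) i) x = 0) :
    Tendsto ahat (inProbability P) (𝓝 a₀) := by
  refine hK.tendsto_nhds_of_unique_mapClusterPt ha fun a haK hcl => huniq a haK fun i => ?_
  obtain ⟨U, hUl, hU⟩ := mapClusterPt_iff_ultrafilter.1 hcl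
  by_contra hne
  set I := ∫ y, ψ y a b₀ i ∂L with hI
  have hIpos : 0 < |I| := abs_pos.2 hne
  have hint : Integrable (fun y => ψ y a b₀ i) L := by
    refine hF.mono' (hmeas a b₀ i).aestronglyMeasurable ?_
    filter_upwards [hae] with y hy
    exact (hy i).2 a haK b₀ hb₀
  -- If the limiting equation failed at the cluster point, `|I|` would be a positive gap. The
  -- modulus with integral at most `|I| / 4` bounds the effect of replacing the estimates by their
  -- limits.
  obtain ⟨δ, hδ, w, -, hwi, hwε, hw⟩ := exists_integrable_modulus (L := L)
    (f := fun y (t : A × B) => |ψ y t.1 t.2 i - ψ y a b₀ i|) (F := fun y => 2 * F y)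
    (s := K ×ˢ V) (t₀ := (a, b₀)) (hF.const_mul 2)
    (fun t _ => ((hmeas _ _ i).sub (hmeas _ _ i)).abs.aemeasurable) (by
      filter_upwards [hae] with y hy
      obtain ⟨hc, hb⟩ := hy i
      refine ⟨(hc.sub continuousOn_const).abs, fun t ht => ?_, ?_⟩
      · refine (abs_sub _ _).trans ?_
        linarith [hb t.1 ht.1 t.2 ht.2, hb a haK b₀ hb₀]
      · have := ((hc (a, b₀) ⟨haK, hb₀⟩).sub continuousWithinAt_const
          (g := fun _ => ψ y a b₀ i)).abs
        simpa [ContinuousWithinAt] using this) (ε := |I| / 4) (by positivity)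
  have hwlt := (hs.tendsto_sampleMean hwi).eventually_lt_const
    (show ∫ y, w y ∂L < |I| / 2 by linarith)
  have hclose : ∀ᶠ x in (U : Filter (ℕ × Ω)), dist (ahat x, bhat x) (a, b₀) < δ :=
    Metric.tendsto_nhds.1 (hU.prodMk_nhds (hb.mono_left hUl)) δ hδ
  have hlim := ((hs.tendsto_sampleMean hint).abs).mono_left hUl
  -- The mean at the estimates is zero, so the mean at `(a, b₀)` is at most that of `w`, below `|I|
  -- / 2`; yet its absolute value tends to `|I|`.
  have hle : |I| ≤ |I| / 2 := by
    refine le_of_tendsto hlim ?_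
    filter_upwards [hwlt.filter_mono hUl, hclose, ha.filter_mono hUl, hroot.filter_mono hUl,
      (hb.eventually (hV.mem_nhds hb₀)).filter_mono hUl,
      (eventually_inProbability_of_ae (hs.ae hw)).filter_mono hUl] with x h1 h2 h3 h4 h5 h6
    have h7 : |sampleMean o (fun y => ψ y (ahat x) (bhat x) i - ψ y a b₀ i) x| ≤
        sampleMean o w x := abs_sampleMean_le fun j => h6 j (ahat x, bhat x) ⟨h3, h5⟩ h2
    rw [sampleMean_sub, h4 i, zero_sub, abs_neg] at h7
    exact h7.trans h1.le
  linarith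

end Consistency

/-! ### The stacked estimating function -/

section Stacked

variable {Ω : Type*} [MeasurableSpace Ω] {P : Measure Ω} {p q k m : ℕ} {c : Scheme}
  {w : Weighting k} {S : Subjects Ω p q k} {M : ErrorModel p k} {Ψ : Score p q m}
  {KΘ : Set (Fin m → ℝ)} {Kτ : Set (Tau p q k)} {Θ₀ : Fin m → ℝ} {τ₀ : Tau p q k}

theorem measurable_predictor (τ : Tau p q k) :
    Measurable fun d : (Fin k → Fin p → ℝ) × (Fin q → ℝ) => predictor τ d.1 d.2 := by
  refine measurable_pi_lambda _ fun r => ?_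
  simp only [predictor, Pi.add_apply, Matrix.mulVec, dotProduct, Finset.sum_apply, Pi.smul_apply,
    smul_eq_mul]
  fun_prop

theorem measurable_rcScore
    (hΨ : ∀ Θ, Measurable fun d : ℝ × (Fin p → ℝ) × (Fin q → ℝ) => Ψ d.1 d.2.1 d.2.2 Θ)
    (Θ : Fin m → ℝ) (τ : Tau p q k) (i : Fin m) :
    Measurable fun y : Obs p q k => rcScore Ψ y Θ τ i := by
  have h : Measurable fun y : Obs p q k => (y.1, predictor τ y.2.1 y.2.2, y.2.2) :=
    measurable_fst.prodMk (((measurable_predictor τ).comp measurable_snd).prodMk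
      (measurable_snd.comp measurable_snd))
  exact (measurable_pi_apply i).comp ((hΨ Θ).comp h)

/-- The projection of the stacked parameter on `(Θ, τ)`. -/
def projOutcome (m p q k : ℕ) : (Idx m p q k → ℝ) →L[ℝ] (Fin m → ℝ) × Tau p q k :=
  (ContinuousLinearMap.pi fun i => .proj (.inl i)).prod
    (ContinuousLinearMap.pi fun t => .proj (.inr (.inl t)))

/-- The projection of the stacked parameter on `(τ, ξ)`. -/
def projPredictor (m p q k : ℕ) : (Idx m p q k → ℝ) →L[ℝ] Tau p q k × Xi p q k :=
  (ContinuousLinearMap.pi fun t => .proj (.inr (.inl t))).prod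
    (ContinuousLinearMap.pi fun b => .proj (.inr (.inr b)))

/-- The projection of the stacked parameter on `ξ`. -/
def projCorrection (m p q k : ℕ) : (Idx m p q k → ℝ) →L[ℝ] Xi p q k :=
  ContinuousLinearMap.pi fun b => .proj (.inr (.inr b))

/-- Where `f` is not differentiable, `fderiv` is zero by convention, so no smoothness is needed.
This gives the zero blocks of `A` at every parameter. -/
theorem fderiv_apply_eq_zero_of_invariant {E : Type*} [NormedAddCommGroup E] [NormedSpace ℝ E]
    {f : E → ℝ} {x v : E} (h : ∀ t : ℝ, f (x + t • v) = f x) : fderiv ℝ f x v = 0 := by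
  by_cases hf : DifferentiableAt ℝ f x
  · rw [← hf.lineDeriv_eq_fderiv, lineDeriv]
    simp [h]
  · rw [fderiv_zero_of_not_differentiableAt hf]
    rfl

theorem matA_hFun_score (L : Measure (Obs p q k)) (θ : Idx m p q k → ℝ) (t : TauIdx p q k)
    (i : Fin m) : matA c w M Ψ L θ (.inr (.inl t)) (.inl i) = 0 := by
  simp only [matA, Matrix.of_apply]
  rw [integral_eq_zero_of_ae]
  refine ae_of_all _ fun y => fderiv_apply_eq_zero_of_invariant fun s => ?_
  simp [stackedFun, stack]

theorem matA_gFun_score (L : Measure (Obs p q k)) (θ : Idx m p q k → ℝ) (b : XiIdx p q k)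
    (i : Fin m) : matA c w M Ψ L θ (.inr (.inr b)) (.inl i) = 0 := by
  simp only [matA, Matrix.of_apply]
  rw [integral_eq_zero_of_ae]
  refine ae_of_all _ fun y => fderiv_apply_eq_zero_of_invariant fun s => ?_
  simp [stackedFun, stack]

theorem matA_gFun_hFun (L : Measure (Obs p q k)) (θ : Idx m p q k → ℝ) (b : XiIdx p q k)
    (t : TauIdx p q k) : matA c w M Ψ L θ (.inr (.inr b)) (.inr (.inl t)) = 0 := by
  simp only [matA, Matrix.of_apply]
  rw [integral_eq_zero_of_ae]
  refine ae_of_all _ fun y => fderiv_apply_eq_zero_of_invariant fun s => ?_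
  simp [stackedFun, stack]

theorem matB_isSymm (L : Measure (Obs p q k)) (θ : Idx m p q k → ℝ) :
    (matB c w M Ψ L θ).IsSymm := by
  ext a b
  simp [matB, mul_comm]

theorem matQ_mulVec (v : Idx m p q k → ℝ) : matQ m p q k *ᵥ v = fun i => v (.inl i) := by
  ext i
  simp [matQ, Matrix.mulVec, dotProduct]

theorem RegularityConditions.fourthMoments
    (hreg : RegularityConditions c w P S M Ψ KΘ Kτ Θ₀ τ₀) : FourthMoments P S :=
  ⟨hreg.memLp_X, hreg.memLp_Z, hreg.memLp_err⟩

theorem IsRCEstimator.eventually {Θhat : ℕ → Ω → Fin m → ℝ} {τhat : ℕ → Ω → Tau p q k}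
    {ξhat : ℕ → Ω → Xi p q k} (h : IsRCEstimator c w P S M Ψ KΘ Kτ Θhat τhat ξhat) :
    ∀ᶠ x in inProbability P, Θhat x.1 x.2 ∈ KΘ ∧ τhat x.1 x.2 ∈ Kτ ∧
      sampleMean (S.obs M) (fun y => stackedFun c w M Ψ y
        (stack (Θhat x.1 x.2) (τhat x.1 x.2) (ξhat x.1 x.2))) x = 0 :=
  h

theorem meanDifferentiableAt_rcScore (hreg : RegularityConditions c w P S M Ψ KΘ Kτ Θ₀ τ₀)
    (i : Fin m) : MeanDifferentiableAt (S.obsLaw M P)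
      (fun y (t : (Fin m → ℝ) × Tau p q k) => rcScore Ψ y t.1 t.2 i) (Θ₀, τ₀) := by
  obtain ⟨W, V, F, hW, hV, hΘ, hτ, hF, hae⟩ := hreg.smooth_Ψ
  refine MeanDifferentiableAt.of_dominated (hW.prod hV) ⟨hΘ, hτ⟩
    (fun t => (measurable_rcScore hreg.measurable_Ψ t.1 t.2 i).aemeasurable) hF ?_
  filter_upwards [hae] with y hy
  have hd := hy.2.2.1.differentiableOn one_ne_zero
  refine ⟨differentiableOn_pi.1 hd i, fun t ht => ?_⟩
  have hdt := hd.differentiableAt ((hW.prod hV).mem_nhds ht)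
  have hi := hasFDerivAt_pi'.1 hdt.hasFDerivAt i
  rw [hi.fderiv]
  refine ContinuousLinearMap.opNorm_le_bound _ ((norm_nonneg _).trans (hy.2.2.2 t ht))
    fun v => ?_
  refine (norm_le_pi_norm
    (fderiv ℝ (fun t : (Fin m → ℝ) × Tau p q k => rcScore Ψ y t.1 t.2) t v) i).trans ?_
  exact (ContinuousLinearMap.le_opNorm _ v).trans (by gcongr; exact hy.2.2.2 t ht)

variable [IsProbabilityMeasure P]

/-- The predictor block is identically zero at the true parameter, so only the outcome and
correction blocks require moments. -/
theorem memLp_stackedFun (hm : IsMeasurementErrorModel P S M)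
    (hreg : RegularityConditions c w P S M Ψ KΘ Kτ Θ₀ τ₀)
    (hh : hFun w τ₀ (trueXi P S M) = 0) (a : Idx m p q k) :
    MemLp (fun y => stackedFun c w M Ψ y (stack Θ₀ τ₀ (trueXi P S M)) a) 2 (S.obsLaw M P) := by
  rcases a with i | t | b
  · exact hreg.memLp_Ψ.eval i
  · have h (y : Obs p q k) :
        stackedFun c w M Ψ y (stack Θ₀ τ₀ (trueXi P S M)) (.inr (.inl t)) = 0 := congrFun hh t
    simp only [h]
    exact MemLp.zero'
  · exact memLp_gFun hm hreg.fourthMoments b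

variable (hm : IsMeasurementErrorModel P S M)
  (hid : Identifiable c P S M) (hreg : RegularityConditions c w P S M Ψ KΘ Kτ Θ₀ τ₀)

include hm hid hreg

theorem meanDifferentiableAt_stackedFun (a : Idx m p q k) :
    MeanDifferentiableAt (S.obsLaw M P) (fun y θ => stackedFun c w M Ψ y θ a)
      (stack Θ₀ τ₀ (trueXi P S M)) := by
  have := isProbabilityMeasure_obsLaw hm
  rcases a with i | t | b
  · exact MeanDifferentiableAt.comp_clm (projOutcome m p q k)
      (θ₀ := stack Θ₀ τ₀ (trueXi P S M))
      (meanDifferentiableAt_rcScore hreg i)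
  · exact MeanDifferentiableAt.comp_clm (projPredictor m p q k)
      (θ₀ := stack Θ₀ τ₀ (trueXi P S M))
      (MeanDifferentiableAt.const (((contDiff_hFun w t).differentiable one_ne_zero) _))
  · exact MeanDifferentiableAt.comp_clm (projCorrection m p q k)
      (θ₀ := stack Θ₀ τ₀ (trueXi P S M))
      (meanDifferentiableAt_gFun hm hreg.fourthMoments hid b)

theorem integral_stackedFun (hΘ : ∫ y, rcScore Ψ y Θ₀ τ₀ ∂(S.obsLaw M P) = 0)
    (hh : hFun w τ₀ (trueXi P S M) = 0) (a : Idx m p q k) :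
    ∫ y, stackedFun c w M Ψ y (stack Θ₀ τ₀ (trueXi P S M)) a ∂(S.obsLaw M P) = 0 := by
  have := isProbabilityMeasure_obsLaw hm
  rcases a with i | t | b
  · have h := eval_integral (fun i => (hreg.memLp_Ψ.eval i).integrable (by norm_num)) i
    rw [hΘ] at h
    exact h.symm
  · have h (y : Obs p q k) :
        stackedFun c w M Ψ y (stack Θ₀ τ₀ (trueXi P S M)) (.inr (.inl t)) = 0 := congrFun hh t
    simp [h]
  · exact integral_gFun hm hreg.fourthMoments hid b

variable {Θhat : ℕ → Ω → Fin m → ℝ} {τhat : ℕ → Ω → Tau p q k} {ξhat : ℕ → Ω → Xi p q k}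
  (hsolve : IsRCEstimator c w P S M Ψ KΘ Kτ Θhat τhat ξhat)

include hsolve

/-- Consistency of the correction parameters, of the predictor parameters and of the regression
calibration estimator; in the limit, the predictor equations hold. -/
theorem tendsto_estimators :
    Tendsto (fun x : ℕ × Ω => ξhat x.1 x.2) (inProbability P) (𝓝 (trueXi P S M)) ∧
    Tendsto (fun x : ℕ × Ω => τhat x.1 x.2) (inProbability P) (𝓝 τ₀) ∧
    Tendsto (fun x : ℕ × Ω => Θhat x.1 x.2) (inProbability P) (𝓝 Θ₀) ∧
    hFun w τ₀ (trueXi P S M) = 0 := by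
  have hev : ∀ᶠ x in inProbability P, Θhat x.1 x.2 ∈ KΘ ∧ τhat x.1 x.2 ∈ Kτ ∧ ∀ a,
      sampleMean (S.obs M) (fun y => stackedFun c w M Ψ y
        (stack (Θhat x.1 x.2) (τhat x.1 x.2) (ξhat x.1 x.2)) a) x = 0 := by
    filter_upwards [hsolve.eventually] with x hx
    refine ⟨hx.1, hx.2.1, fun a => ?_⟩
    rw [← sampleMean_apply, hx.2.2]
    rfl
  have hξ := tendsto_of_sampleMean_gFun_eq_zero hm hreg.fourthMoments hid
    (ξ := fun x => ξhat x.1 x.2) (hev.mono fun x hx b => hx.2.2 (.inr (.inr b)))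
  have hroot : ∀ᶠ x in inProbability P, hFun w (τhat x.1 x.2) (ξhat x.1 x.2) = 0 := by
    filter_upwards [hev, eventually_inProbability_of_atTop (p := fun n => n ≠ 0)
      (eventually_ne_atTop 0)] with x hx hxn
    ext t
    have h : sampleMean (S.obs M) (fun _ => hFun w (τhat x.1 x.2) (ξhat x.1 x.2) t) x = 0 :=
      hx.2.2 (.inr (.inl t))
    rwa [sampleMean_const hxn] at h
  -- Each stage takes the preceding limit as a plugged-in nuisance parameter: `ξ` for `τ`, and then
  -- `τ` for `Θ`.
  have hτ := tendsto_of_hFun_eq_zero hreg.compact_τ hreg.unique_τ hξ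
    (hev.mono fun x hx => hx.2.1) hroot
  refine ⟨hξ, hτ, ?_, ?_⟩
  · obtain ⟨W, V, F, hW, hV, hΘ, hτV, hF, hae⟩ := hreg.smooth_Ψ
    refine tendsto_of_sampleMean_eq_zero (ψ := fun y Θ τ => rcScore Ψ y Θ τ) (V := V)
      hm.isIIDSample hreg.compact_Θ hV hτV (measurable_rcScore hreg.measurable_Ψ) hF ?_
      (fun Θ hΘK h => hreg.unique_Θ Θ hΘK ?_) hτ (hev.mono fun x hx => hx.1)
      (hev.mono fun x hx i => hx.2.2 (.inl i))
    · filter_upwards [hae] with y hy i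
      refine ⟨fun t ht => (continuousWithinAt_pi.1 (hy.1 t ht)) i, fun Θ hΘ τ hτ => ?_⟩
      exact (norm_le_pi_norm (rcScore Ψ y Θ τ) i).trans (hy.2.1 Θ hΘ τ hτ)
    · ext i
      rw [eval_integral fun i => ?_]
      · exact h i
      · refine hF.mono' (measurable_rcScore hreg.measurable_Ψ _ _ i).aestronglyMeasurable ?_
        filter_upwards [hae] with y hy
        exact (norm_le_pi_norm (rcScore Ψ y Θ τ₀) i).trans (hy.2.1 Θ hΘK τ₀ hτV)
  -- The estimates solve the predictor equations with probability tending to one, and continuity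
  -- carries the equations to the limit.
  · have h := ((continuous_hFun w).tendsto (τ₀, trueXi P S M)).comp (hτ.prodMk_nhds hξ)
    refine tendsto_nhds_unique h (tendsto_const_nhds.congr' ?_)
    filter_upwards [hroot] with x hx
    exact hx.symm

end Stacked

end RC

end

/-! ### Asymptotic normality of the regression calibration estimator -/

theorem theorem2 {Ω : Type*} [MeasurableSpace Ω] {P : Measure Ω} [IsProbabilityMeasure P]
    {p q k m : ℕ} (c : RC.Scheme) (w : RC.Weighting k)
    (S : RC.Subjects Ω p q k) (M : RC.ErrorModel p k) (Ψ : RC.Score p q m)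
    (KΘ : Set (Fin m → ℝ)) (Kτ : Set (RC.Tau p q k))
    (ΘRC : Fin m → ℝ) (τ₀ : RC.Tau p q k)
    (hmodel : RC.IsMeasurementErrorModel P S M)
    (hident : RC.Identifiable c P S M)
    (hτ₀ : RC.IsBLUP w P S M τ₀)
    (hΘRC : ∫ o, RC.rcScore Ψ o ΘRC τ₀ ∂(S.obsLaw M P) = 0)
    (hreg : RC.RegularityConditions c w P S M Ψ KΘ Kτ ΘRC τ₀)
    (Θhat : ℕ → Ω → Fin m → ℝ) (τhat : ℕ → Ω → RC.Tau p q k) (ξhat : ℕ → Ω → RC.Xi p q k)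
    (hmeas : ∀ n, AEMeasurable (Θhat n) P)
    (hsolve : RC.IsRCEstimator c w P S M Ψ KΘ Kτ Θhat τhat ξhat) :
    -- consistency
    TendstoInMeasure P Θhat atTop (fun _ => ΘRC) ∧
    -- asymptotic normality with the sandwich covariance
    (RC.sandwich (RC.ARC c w P S M Ψ ΘRC τ₀) (RC.BRC c w P S M Ψ ΘRC τ₀)).PosSemidef ∧
    TendstoInDistribution
      (fun (n : ℕ) ω => WithLp.toLp 2 (√(n : ℝ) • (Θhat n ω - ΘRC))) atTop
      (id : EuclideanSpace ℝ (Fin m) → EuclideanSpace ℝ (Fin m)) (fun _ => P)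
      (multivariateGaussian 0
        (RC.sandwich (RC.ARC c w P S M Ψ ΘRC τ₀) (RC.BRC c w P S M Ψ ΘRC τ₀))) ∧
    -- `A` is block upper triangular
    (∀ t i, RC.ARC c w P S M Ψ ΘRC τ₀ (.inr (.inl t)) (.inl i) = 0) ∧
    (∀ s i, RC.ARC c w P S M Ψ ΘRC τ₀ (.inr (.inr s)) (.inl i) = 0) ∧
    (∀ s t, RC.ARC c w P S M Ψ ΘRC τ₀ (.inr (.inr s)) (.inr (.inl t)) = 0) ∧
    -- `B` is symmetric and its blocks that involve the predictor equations vanish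
    (RC.BRC c w P S M Ψ ΘRC τ₀).IsSymm ∧
    (∀ t b, RC.BRC c w P S M Ψ ΘRC τ₀ (.inr (.inl t)) b = 0) := by
  obtain ⟨hξ, hτ, hΘ, hh⟩ := RC.tendsto_estimators hmodel hident hreg hsolve
  have hL2 := RC.memLp_stackedFun hmodel hreg hh
  have hmean := RC.integral_stackedFun hmodel hident hreg hΘRC hh
  have hs := hmodel.isIIDSample
  set A := RC.ARC c w P S M Ψ ΘRC τ₀ with hA
  set B := RC.BRC c w P S M Ψ ΘRC τ₀ with hB
  set θ₀ := RC.stack ΘRC τ₀ (RC.trueXi P S M) with hθ₀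
  have hθ : Tendsto (fun x : ℕ × Ω => RC.stack (Θhat x.1 x.2) (τhat x.1 x.2) (ξhat x.1 x.2))
      (RC.inProbability P) (𝓝 θ₀) := by
    refine tendsto_pi_nhds.2 fun a => ?_
    rcases a with i | t | b
    · exact tendsto_pi_nhds.1 hΘ i
    · exact tendsto_pi_nhds.1 hτ t
    · exact tendsto_pi_nhds.1 hξ b
  have hroot : ∀ᶠ x in RC.inProbability P, RC.sampleMean (S.obs M) (fun y =>
      RC.stackedFun c w M Ψ y (RC.stack (Θhat x.1 x.2) (τhat x.1 x.2) (ξhat x.1 x.2))) x = 0 :=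
    hsolve.eventually.mono fun x hx => hx.2.2
  have hlin := RC.tendsto_sqrt_smul_estimator_add hs
    (RC.meanDifferentiableAt_stackedFun hmodel hident hreg) hL2 hmean (A := A)
    (fun a b => rfl) hreg.det_A hθ hroot
  -- the influence function of the estimator and its second moments
  let G : Matrix (Fin m) (RC.Idx m p q k) ℝ := RC.matQ m p q k * A⁻¹
  let f : RC.Obs p q k → Fin m → ℝ := fun y => -(G *ᵥ RC.stackedFun c w M Ψ y θ₀)
  have hfL2 (i : Fin m) : MemLp (fun y => f y i) 2 (S.obsLaw M P) :=
    (memLp_finsetSum _ fun a _ => (hL2 a).const_mul (G i a)).neg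
  have hf0 (i : Fin m) : ∫ y, f y i ∂(S.obsLaw M P) = 0 := by
    have := RC.isProbabilityMeasure_obsLaw hmodel
    simp only [f, Pi.neg_apply, Matrix.mulVec, dotProduct]
    rw [integral_neg, integral_finsetSum _ fun a _ =>
      ((hL2 a).integrable (by norm_num)).const_mul _]
    simp [integral_const_mul, hmean]
  -- With `G = Q A⁻¹` the sandwich is `G B Gᵀ`, the second moment matrix of `-G ψ(θ₀)`; the sign
  -- cancels in the product.
  have hC (i j : Fin m) : RC.sandwich A B i j = ∫ y, f y i * f y j ∂(S.obsLaw M P) := by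
    have hsand : RC.sandwich A B = G * B * Gᵀ := by
      simp only [RC.sandwich, G, Matrix.transpose_mul, Matrix.mul_assoc]
    have hff (y : RC.Obs p q k) : f y i * f y j = ∑ b, ∑ a, G i a *
        (RC.stackedFun c w M Ψ y θ₀ a * RC.stackedFun c w M Ψ y θ₀ b) * G j b := by
      simp only [f, Pi.neg_apply, neg_mul_neg, Matrix.mulVec, dotProduct, Finset.sum_mul_sum]
      rw [Finset.sum_comm]
      exact Finset.sum_congr rfl fun b _ => Finset.sum_congr rfl fun a _ => by ring
    have hint (a b : RC.Idx m p q k) : Integrable (fun y => G i a *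
        (RC.stackedFun c w M Ψ y θ₀ a * RC.stackedFun c w M Ψ y θ₀ b) * G j b) (S.obsLaw M P) :=
      (((hL2 a).integrable_mul (hL2 b)).const_mul _).mul_const _
    simp only [hff]
    rw [integral_finsetSum _ fun b _ => integrable_finsetSum _ fun a _ => hint a b, hsand]
    simp only [Matrix.mul_apply, Matrix.transpose_apply, Finset.sum_mul]
    refine Finset.sum_congr rfl fun b _ => ?_
    rw [integral_finsetSum _ fun a _ => hint a b]
    refine Finset.sum_congr rfl fun a _ => ?_
    rw [integral_mul_const, integral_const_mul]
    rfl
  refine ⟨RC.tendsto_inProbability_iff.1 hΘ, RC.posSemidef_secondMoment hfL2 hC, ?_,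
    fun t i => RC.matA_hFun_score _ _ t i, fun s i => RC.matA_gFun_score _ _ s i,
    fun s t => RC.matA_gFun_hFun _ _ s t, RC.matB_isSymm _ _, fun t b => ?_⟩
  -- Slutsky: the scaled error of `Θ̂` differs from the scaled mean of the influence function by the
  -- `Q`-image of the linearization error, which vanishes in probability.
  · refine tendstoInDistribution_of_tendstoInMeasure_sub _ _
      (hs.tendstoInDistribution hfL2 hf0 hC) ?_ fun n => ?_
    · change TendstoInMeasure P _ atTop fun _ => (0 : EuclideanSpace ℝ (Fin m))
      refine RC.tendsto_inProbability_iff.1 ?_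
      have hQ := (((PiLp.continuous_toLp 2 fun _ : Fin m => ℝ).comp
        (LinearMap.continuous_of_finiteDimensional (RC.matQ m p q k).mulVecLin)).tendsto 0).comp
        hlin
      simp only [Function.comp_apply, map_zero, WithLp.toLp_zero] at hQ
      refine hQ.congr fun x => ?_
      have hmf : RC.sampleMean (S.obs M) f x =
          -(G *ᵥ RC.sampleMean (S.obs M) (fun y => RC.stackedFun c w M Ψ y θ₀) x) := by
        simp [RC.sampleMean, f, Matrix.mulVec_smul, Matrix.mulVec_sum]
      simp only [Pi.sub_apply, ← WithLp.toLp_sub, Function.comp_apply, Matrix.mulVecLin_apply,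
        Matrix.mulVec_add, hmf, Matrix.mulVec_smul, G, smul_neg, sub_neg_eq_add,
        Matrix.mulVec_mulVec]
      rw [RC.matQ_mulVec]
      rfl
    · exact (WithLp.measurable_toLp 2 (Fin m → ℝ)).comp_aemeasurable
        (((hmeas n).sub_const ΘRC).const_smul (√(n : ℝ)))
  · have h (y : RC.Obs p q k) : RC.stackedFun c w M Ψ y θ₀ (.inr (.inl t)) = 0 := congrFun hh t
    simp only [hB, RC.BRC, RC.matB, Matrix.of_apply, ← hθ₀, h, zero_mul, integral_zero]
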